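/- **Setting.** Consider $M$ agents with states $x_i\in\mathbb R^{n_i}$, inputs $u_i\in\mathbb R^{m_i}$ and dynamics $$\dot x_i=f_i(x_i,t)+g_i(x_i,t)u_i+c_i(x,t),\qquad x=(x_1,\dots,x_M),\ t\ge 0,$$ where $f_i,g_i,c_i$ are locally Lipschitz in the state and measurable in $t$, $g_i(x_i,t)$ has full row rank for all $(x_i,t)$, and the $c_i$ are unknown except for a known bound $\|c_i(x,t)\|\le C$. The agents are partitioned into $\mathcal V_1,\dots,\mathcal V_K$; any two distinct agents of the same $\mathcal V_k$ are joined by an edge of the undirected communication graph. Write $\bar x_k$ for the stacked states of the agents in $\mathcal V_k$ and $\bar n_k=\sum_{i\in\mathcal V_k}n_i$. **Formulas.** For each $k$, $\phi_k$ is a signal temporal logic (STL) formula over $\bar x_k$ from the fragment $$\psi::=\top\mid\mu\mid\neg\mu\mid\psi'\wedge\psi'',\qquad \phi::=G_{[a,b]}\psi\mid F_{[a,b]}\psi\mid\psi'\,U_{[a,b]}\,\psi''\mid\phi'\wedge\phi'',$$ with $0\le a\le b<\infty$ and $b>0$. Each predicate $\mu$ has a $C^1$ predicate function $h$ and is true at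 $\zeta$ iff $h(\zeta)\ge0$. Fix one of two conventions for the until operator: $\theta(a)=0$ (standard) or $\theta(a)=a$. A signal satisfies $\phi'U_{[a,b]}\phi''$ at $t$ iff $\phi''$ holds at some $t'\in[t+a,t+b]$ and $\phi'$ holds on $[t+\theta(a),t']$. The other semantics are the usual ones, and $x\models\phi$ means satisfaction at time $0$. The horizon of $\phi$ is the largest right end point $b$ of its intervals. **Barrier functions.** For each $k$ let $$\mathfrak b^k(\bar x_k,t)=-\tfrac1\eta\ln\Big(\sum_l\mathfrak o_l(t)e^{-\eta\mathfrak b_l(\bar x_k,t)}\Big),\qquad \eta>0,$$ where the $\mathfrak b_l$ are continuous on $\mathbb R^{\bar n_k}\times[0,\infty)$, with one $\mathfrak b_l$ for each occurrence of a predicate in each temporal operator of $\phi_k$. If that operator has interval $[a_l,b_l]$, then $\mathfrak o_l(t)=1$ for $t<b_l$ and $\mathfrak o_l(t)=0$ for $t\ge b_l$. One further continuous function, never removed, may be added to the sum. The $\mathfrak b_l$ satisfy the following conditions, in which "$\mathfrak b_l$ accounts for its literal at $t$" means $\mathfrak b_l(\cdot,t)\le h$ if the literal is $\mu$ and $\mathfrak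 b_l(\cdot,t)<-h$ if it is $\neg\mu$: * for $G_{[a,b]}\psi$: each $\mathfrak b_l$ of $\psi$ accounts for its literal at all $t\in[a,b]$; * for $F_{[a,b]}\psi$: there is $t'\in[a,b]$ at which each $\mathfrak b_l$ of $\psi$ accounts for its literal; * for $\psi'U_{[a,b]}\psi''$: there is $t'\in[a,b]$ such that each $\mathfrak b_l$ of $\psi''$ accounts for its literal at $t'$, and each $\mathfrak b_l$ of $\psi'$ does so at all $t\in[\theta(a),t']$. Let $0=s^k_0<s^k_1<\dots<s^k_{q_k}$ be $0$ followed by the distinct values of the $b_l$, and let $\mathfrak C_k(t)=\{\bar x_k:\mathfrak b^k(\bar x_k,t)\ge0\}$ (the whole space if the sum is empty). Assume the following, for each $k$ and each interval $[s^k_j,s^k_{j+1})$. * $\mathfrak b^k$ is a candidate control barrier function: it is $C^1$ on $\mathbb R^{\bar n_k}\times(s_j^k,s_{j+1}^k)$, and from each point of $\mathfrak C_k(s^k_j)$ there starts a (locally) absolutely continuous curve on $[s^k_j,s^k_{j+1})$ with value in $\mathfrak C_k(t)$ at each time $t$. * There are an open bounded set $\mathfrak D_k$, the same for all $j$, with $\mathfrak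 C_k(t)\subseteq\mathfrak D_k$ for all $t\in[s_j^k,s_{j+1}^k)$, and a strictly increasing, locally Lipschitz $\alpha_k:\mathbb R\to\mathbb R$ with $\alpha_k(0)=0$, also the same for all $j$, such that $\frac{\partial\mathfrak b^k}{\partial t}>-\alpha_k(\mathfrak b^k)$ at all points of $\mathfrak D_k\times(s^k_j,s^k_{j+1})$ where $\frac{\partial\mathfrak b^k}{\partial\bar x_k}=0$. **Control law.** For $i\in\mathcal V_k$, consider the quadratic program $$\min_{u_i}\ u_i^Tu_i\quad\text{s.t.}\quad \frac{\partial\mathfrak b^k}{\partial x_i}\big(f_i+g_iu_i\big)\ \ge\ \Big\|\frac{\partial\mathfrak b^k}{\partial x_i}\Big\|\hat n\,C-\mathfrak N_i\Big(\frac{\partial\mathfrak b^k}{\partial t}+\alpha_k(\mathfrak b^k)\Big),$$ where $\hat n=\sqrt{\bar n_k\max(n_1,\dots,n_M)}$, and $\mathfrak N_i=\big\|\frac{\partial\mathfrak b^k}{\partial x_i}\big\|\big/\sum_{d\in\mathcal V_k}\big\|\frac{\partial\mathfrak b^k}{\partial x_d}\big\|$ if the denominator is nonzero, $\mathfrak N_i=1$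 otherwise. **Claim.** At every point $(\bar x_k,t)\in\mathfrak D_k\times(s^k_j,s^k_{j+1})$ this program has exactly one solution. Suppose each agent $i\in\mathcal V_k$ applies a feedback $u_i(\bar x_k,t)$ that equals this solution at all such points (and is arbitrary elsewhere). Let $x:[0,T]\to\mathbb R^{n_1+\dots+n_M}$, $T>0$, be any Filippov solution of the closed-loop system. Then, for each $k$ with $\bar x_k(0)\in\mathfrak C_k(0)$: $\bar x_k(t)\in\mathfrak C_k(t)$ for all $t\in[0,T]$ with $t<s^k_{q_k}$, and, if $T$ is at least the horizon of $\phi_k$, $\bar x_k\models\phi_k$. -/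

import Mathlib

open Set MeasureTheory

noncomputable section

/-! ## Signal temporal logic -/

/-- Formulas of signal temporal logic over the state space `E`. A predicate is given by its
predicate function `h`; the predicate is true at `x` iff `0 ≤ h x`. -/
inductive STL (E : Type) : Type
  | tt : STL E
  | pred (h : E → ℝ) : STL E
  | neg (φ : STL E) : STL E
  | and (φ φ' : STL E) : STL E
  | untl (a b : ℝ) (φ φ' : STL E) : STL E

/-- The two conventions for the left operand of `φ' U_[a,b] φ''` evaluated at time `t`: with
witness time `t'`, the formula `φ'` has to hold on `[t, t']` (`fromNow`), or on `[t + a, t']`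
(`fromWindow`). They coincide for `a = 0`. -/
inductive UntilConvention : Type
  | fromNow
  | fromWindow

/-- The offset at which the left operand of `U_[a,b]` starts to be required. -/
def UntilConvention.start : UntilConvention → ℝ → ℝ
  | fromNow, _ => 0
  | fromWindow, a => a

namespace STL

variable {E : Type}

/-- `F_[a,b] φ := ⊤ U_[a,b] φ`. -/
def ev (a b : ℝ) (φ : STL E) : STL E := untl a b tt φ

/-- `G_[a,b] φ := ¬ F_[a,b] ¬ φ`. -/
def alw (a b : ℝ) (φ : STL E) : STL E := neg (ev a b (neg φ))

/-- Boolean semantics: the signal `x` satisfies the formula at time `t`. -/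
def Sat (r : UntilConvention) (x : ℝ → E) : STL E → ℝ → Prop
  | tt, _ => True
  | pred h, t => 0 ≤ h (x t)
  | neg φ, t => ¬ Sat r x φ t
  | and φ φ', t => Sat r x φ t ∧ Sat r x φ' t
  | untl a b φ φ', t => ∃ t' ∈ Icc (t + a) (t + b), Sat r x φ' t' ∧
      ∀ t'' ∈ Icc (t + r.start a) t', Sat r x φ t''

end STL

/-- The class `ψ ::= ⊤ | μ | ¬ μ | ψ' ∧ ψ''`. -/
inductive PsiFormula (E : Type) : Type
  | tt : PsiFormula E
  | pred (h : E → ℝ) : PsiFormula E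
  | negPred (h : E → ℝ) : PsiFormula E
  | and (ψ ψ' : PsiFormula E) : PsiFormula E

/-- The class `φ ::= G_[a,b] ψ | F_[a,b] ψ | ψ' U_[a,b] ψ'' | φ' ∧ φ''`. -/
inductive PhiFormula (E : Type) : Type
  | alw (a b : ℝ) (ψ : PsiFormula E) : PhiFormula E
  | ev (a b : ℝ) (ψ : PsiFormula E) : PhiFormula E
  | untl (a b : ℝ) (ψ ψ' : PsiFormula E) : PhiFormula E
  | and (φ φ' : PhiFormula E) : PhiFormula E

namespace PsiFormula

/-- The underlying STL formula. -/
def toSTL {E : Type} : PsiFormula E → STL E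
  | tt => STL.tt
  | pred h => STL.pred h
  | negPred h => STL.neg (STL.pred h)
  | and ψ ψ' => STL.and ψ.toSTL ψ'.toSTL

/-- All predicate functions are continuously differentiable. -/
def Smooth {E : Type} [NormedAddCommGroup E] [NormedSpace ℝ E] : PsiFormula E → Prop
  | tt => True
  | pred h => ContDiff ℝ 1 h
  | negPred h => ContDiff ℝ 1 h
  | and ψ ψ' => ψ.Smooth ∧ ψ'.Smooth

end PsiFormula

namespace PhiFormula

/-- The underlying STL formula. -/
def toSTL {E : Type} : PhiFormula E → STL E
  | alw a b ψ => STL.alw a b ψ.toSTL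
  | ev a b ψ => STL.ev a b ψ.toSTL
  | untl a b ψ ψ' => STL.untl a b ψ.toSTL ψ'.toSTL
  | and φ φ' => STL.and φ.toSTL φ'.toSTL

/-- All predicate functions are continuously differentiable, and all time intervals `[a, b]`
satisfy `0 ≤ a ≤ b` and `0 < b`. -/
def WellFormed {E : Type} [NormedAddCommGroup E] [NormedSpace ℝ E] : PhiFormula E → Prop
  | alw a b ψ => (0 ≤ a ∧ a ≤ b ∧ 0 < b) ∧ ψ.Smooth
  | ev a b ψ => (0 ≤ a ∧ a ≤ b ∧ 0 < b) ∧ ψ.Smooth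
  | untl a b ψ ψ' => (0 ≤ a ∧ a ≤ b ∧ 0 < b) ∧ ψ.Smooth ∧ ψ'.Smooth
  | and φ φ' => φ.WellFormed ∧ φ'.WellFormed

/-- The largest right end point of the time intervals in the formula. -/
def horizon {E : Type} : PhiFormula E → ℝ
  | alw _ b _ => b
  | ev _ b _ => b
  | untl _ b _ _ => b
  | and φ φ' => max φ.horizon φ'.horizon

end PhiFormula

/-! ## Control barrier functions for formulas -/

/-- The data of `𝔟(x,t) = -(1/η) ln (∑ₗ 𝔬ₗ(t) exp (-η 𝔟ₗ(x,t)))`: the functions `𝔟ₗ`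
attached to temporal operators, each paired with the right end point `bₗ` of the time interval
of its operator (the time at which `𝔟ₗ` is removed), and possibly one further function which
is never removed (its purpose is to keep the set `𝔟 ≥ 0` bounded). -/
structure BarrierData (E : Type) where
  comps : List ((E → ℝ → ℝ) × ℝ)
  extra : Option (E → ℝ → ℝ)
  η : ℝ

namespace BarrierData

variable {E : Type}

/-- `∑ₗ 𝔬ₗ(t) exp (-η 𝔟ₗ(x,t))`, where `𝔬ₗ(t) = 1` for `t < bₗ` and `𝔬ₗ(t) = 0` for
`bₗ ≤ t`. -/
def expSum (B : BarrierData E) (x : E) (t : ℝ) : ℝ :=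
  (B.comps.map fun c => if t < c.2 then Real.exp (-B.η * c.1 x t) else 0).sum
    + B.extra.elim 0 fun e => Real.exp (-B.η * e x t)

/-- The function `𝔟(x,t)`. -/
def val (B : BarrierData E) (x : E) (t : ℝ) : ℝ := -(1 / B.η) * Real.log (B.expSum x t)

/-- The set `ℭ(t) = {x | 𝔟(x,t) ≥ 0}`. -/
def safeSet (B : BarrierData E) (t : ℝ) : Set E := {x | 0 ≤ B.val x t}

/-- The removal times `bₗ`. -/
def times (B : BarrierData E) : Set ℝ := {r | ∃ c ∈ B.comps, c.2 = r}

/-- `[s, s')` is one of the intervals `[s_j, s_{j+1})` of the switching sequence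
`s_0 = 0 < s_1 < ... < s_q`, where `s_{j+1}` is the smallest removal time after `s_j`. -/
def IsSwitchInterval (B : BarrierData E) (s s' : ℝ) : Prop :=
  (s = 0 ∨ s ∈ B.times) ∧ IsLeast {r | r ∈ B.times ∧ s < r} s'

variable [NormedAddCommGroup E] [NormedSpace ℝ E]

/-- `𝔟` is a candidate control barrier function for `[s, s')`: it is continuously
differentiable on `E × (s, s')`, and from each point of `ℭ(s)` there starts a (locally)
absolutely continuous function on `[s, s')` that stays in `ℭ(t)`. -/
def IsCCBF (B : BarrierData E) (s s' : ℝ) : Prop :=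
  ContDiffOn ℝ 1 (fun p : E × ℝ => B.val p.1 p.2) (univ ×ˢ Ioo s s') ∧
  ∀ x₀ ∈ B.safeSet s, ∃ x : ℝ → E, x s = x₀ ∧
    (∀ τ ∈ Ioo s s', AbsolutelyContinuousOnInterval x s τ) ∧
    ∀ t ∈ Ico s s', x t ∈ B.safeSet t

end BarrierData

/-- The list `L` has one function for each predicate of `ψ`, below the corresponding predicate
function at all times in `S`. For `¬ μ` the predicate function is `-h`, and the inequality is
strict because `¬ μ` is true iff `0 < -h`. -/
def EncodesPsi {E : Type} (S : Set ℝ) : PsiFormula E → List (E → ℝ → ℝ) → Prop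
  | .tt, L => L = []
  | .pred h, L => ∃ b : E → ℝ → ℝ, L = [b] ∧ ∀ t ∈ S, ∀ x, b x t ≤ h x
  | .negPred h, L => ∃ b : E → ℝ → ℝ, L = [b] ∧ ∀ t ∈ S, ∀ x, b x t < -h x
  | .and ψ ψ', L => ∃ L₁ L₂, L = L₁ ++ L₂ ∧ EncodesPsi S ψ L₁ ∧ EncodesPsi S ψ' L₂

/-- The functions in `L`, with their removal times, fulfil the conditions that account for the
STL semantics of `φ`. -/
def EncodesPhi {E : Type} (r : UntilConvention) :
    PhiFormula E → List ((E → ℝ → ℝ) × ℝ) → Prop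
  | .alw a b ψ, L => ∃ L₁, L = L₁.map (fun f => (f, b)) ∧ EncodesPsi (Icc a b) ψ L₁
  | .ev a b ψ, L => ∃ L₁, L = L₁.map (fun f => (f, b)) ∧
      ∃ t' ∈ Icc a b, EncodesPsi {t'} ψ L₁
  | .untl a b ψ ψ', L => ∃ L₁ L₂, L = (L₁ ++ L₂).map (fun f => (f, b)) ∧
      ∃ t' ∈ Icc a b, EncodesPsi {t'} ψ' L₂ ∧ EncodesPsi (Icc (r.start a) t') ψ L₁
  | .and φ φ', L => ∃ L₁ L₂, L = L₁ ++ L₂ ∧ EncodesPhi r φ L₁ ∧ EncodesPhi r φ' L₂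

/-- The barrier function accounts for the STL semantics of `φ`: `η > 0`, all functions `𝔟ₗ`
are continuous on `E × [0, ∞)`, and they fulfil the conditions for `φ`. -/
def AccountsFor {E : Type} [TopologicalSpace E] (r : UntilConvention) (φ : PhiFormula E)
    (B : BarrierData E) : Prop :=
  0 < B.η ∧
  (∀ c ∈ B.comps, ContinuousOn (fun p : E × ℝ => c.1 p.1 p.2) (univ ×ˢ Ici 0)) ∧
  (∀ e ∈ B.extra, ContinuousOn (fun p : E × ℝ => e p.1 p.2) (univ ×ˢ Ici 0)) ∧
  EncodesPhi r φ B.comps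

/-- Extended class `𝒦` functions that are locally Lipschitz continuous. -/
def IsExtClassK (α : ℝ → ℝ) : Prop := StrictMono α ∧ α 0 = 0 ∧ LocallyLipschitz α

/-! ## Filippov solutions -/

/-- The Filippov set-valued map `F[X](x,t)`: the intersection, over all `δ > 0` and all
Lebesgue null sets `N`, of the closed convex hulls of `X(B(x,δ) \ N, t)`. -/
def filippovMap {E : Type} [NormedAddCommGroup E] [NormedSpace ℝ E] [MeasureSpace E]
    (X : E → ℝ → E) (x : E) (t : ℝ) : Set E :=
  ⋂ (δ : ℝ) (_ : 0 < δ) (N : Set E) (_ : volume N = 0),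
    closure (convexHull ℝ ((fun y => X y t) '' (Metric.ball x δ \ N)))

/-- `x` is a Filippov solution of `ẋ = X(x,t)` on `[0, T]`. -/
def IsFilippovSolution {E : Type} [NormedAddCommGroup E] [NormedSpace ℝ E] [MeasureSpace E]
    (X : E → ℝ → E) (T : ℝ) (x : ℝ → E) : Prop :=
  AbsolutelyContinuousOnInterval x 0 T ∧
  ∀ᵐ t, t ∈ Ioo 0 T → ∃ v ∈ filippovMap X (x t) t, HasDerivAt x v t

/-! ## Multi-agent systems -/

/-- The state space `ℝ^{n_j}, j ∈ J`, stacked, with the Euclidean norm. -/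
abbrev StackedState {J : Type} (n : J → ℕ) : Type :=
  PiLp 2 fun j : J => EuclideanSpace ℝ (Fin (n j))

/-- The data of `M` agents `ẋ_i = f_i(x_i,t) + g_i(x_i,t) u_i + c_i(x,t)`. -/
structure MultiAgentSystem (M : ℕ) where
  n : Fin M → ℕ
  m : Fin M → ℕ
  f : (i : Fin M) → EuclideanSpace ℝ (Fin (n i)) → ℝ → EuclideanSpace ℝ (Fin (n i))
  g : (i : Fin M) → EuclideanSpace ℝ (Fin (n i)) → ℝ → Matrix (Fin (n i)) (Fin (m i)) ℝ
  c : (i : Fin M) → StackedState n → ℝ → EuclideanSpace ℝ (Fin (n i))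

namespace MultiAgentSystem

variable {M K : ℕ} (S : MultiAgentSystem M)

/-- `f_i`, `g_i`, `c_i` are locally Lipschitz in the state and measurable in `t ≥ 0`. -/
def Regular : Prop :=
  ∀ i,
    (∀ t, 0 ≤ t → LocallyLipschitz fun x => S.f i x t) ∧
    (∀ t, 0 ≤ t → ∀ p q, LocallyLipschitz fun x => S.g i x t p q) ∧
    (∀ t, 0 ≤ t → LocallyLipschitz fun x => S.c i x t) ∧
    (∀ x, Measurable fun t : Ici (0 : ℝ) => S.f i x t) ∧
    (∀ x p q, Measurable fun t : Ici (0 : ℝ) => S.g i x t p q) ∧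
    (∀ x, Measurable fun t : Ici (0 : ℝ) => S.c i x t)

/-- Each `g_i(x_i,t)` has full row rank. -/
def FullRowRank : Prop := ∀ i x t, 0 ≤ t → (S.g i x t).rank = S.n i

/-- The functions `c_i` are bounded by `C`. -/
def CouplingBound (C : ℝ) : Prop := ∀ i x t, 0 ≤ t → ‖S.c i x t‖ ≤ C

/-- The state space of all agents. -/
abbrev State : Type := StackedState S.n

/-- The space of the stacked states `x̄_k` of the agents in `𝒱_k = {i | κ i = k}`. -/
abbrev GroupState (κ : Fin M → Fin K) (k : Fin K) : Type :=
  StackedState fun i : {i : Fin M // κ i = k} => S.n i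

/-- `x ↦ x̄_k`. -/
def groupProj (κ : Fin M → Fin K) (k : Fin K) (x : S.State) : S.GroupState κ k :=
  WithLp.toLp 2 fun i => x i

/-- `∂𝔟(x̄_k,t)/∂x_i`. -/
def partialGrad (κ : Fin M → Fin K) {k : Fin K} (b : S.GroupState κ k → ℝ → ℝ)
    (xb : S.GroupState κ k) (t : ℝ) (i : {i : Fin M // κ i = k}) :
    EuclideanSpace ℝ (Fin (S.n i)) :=
  (gradient (fun y => b y t) xb) i

/-- The load sharing function `𝔑_i(x̄_k,t)`. -/
def loadShare (κ : Fin M → Fin K) {k : Fin K} (b : S.GroupState κ k → ℝ → ℝ)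
    (xb : S.GroupState κ k) (t : ℝ) (i : {i : Fin M // κ i = k}) : ℝ :=
  if ∑ d, ‖S.partialGrad κ b xb t d‖ ≠ 0 then
    ‖S.partialGrad κ b xb t i‖ / ∑ d, ‖S.partialGrad κ b xb t d‖
  else 1

/-- `n̂ = √(n̄_k max(n_1, ..., n_M))`, where `n̄_k = ∑_{i ∈ 𝒱_k} n_i`. -/
def nHat (κ : Fin M → Fin K) (k : Fin K) : ℝ :=
  Real.sqrt ((∑ i : {i : Fin M // κ i = k}, (S.n i : ℝ)) * (Finset.univ.sup S.n : ℕ))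

/-- The inputs `u_i` that satisfy the linear constraint of the quadratic program of agent `i`. -/
def qpFeasible (κ : Fin M → Fin K) {k : Fin K} (b : S.GroupState κ k → ℝ → ℝ) (α : ℝ → ℝ)
    (C : ℝ) (xb : S.GroupState κ k) (t : ℝ) (i : {i : Fin M // κ i = k}) :
    Set (EuclideanSpace ℝ (Fin (S.m i))) :=
  {v | ‖S.partialGrad κ b xb t i‖ * S.nHat κ k * C
        - S.loadShare κ b xb t i * (deriv (fun s => b xb s) t + α (b xb t))
      ≤ inner ℝ (S.partialGrad κ b xb t i)
          (S.f i (xb i) t + Matrix.toEuclideanLin (S.g i (xb i) t) v)}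

/-- `v` is a solution of the minimum norm quadratic program of agent `i`: it minimizes `vᵀv`
over the feasible inputs. -/
def IsQPSolution (κ : Fin M → Fin K) {k : Fin K} (b : S.GroupState κ k → ℝ → ℝ)
    (α : ℝ → ℝ) (C : ℝ) (xb : S.GroupState κ k) (t : ℝ) (i : {i : Fin M // κ i = k})
    (v : EuclideanSpace ℝ (Fin (S.m i))) : Prop :=
  v ∈ S.qpFeasible κ b α C xb t i ∧
    IsMinOn (fun w => inner ℝ w w) (S.qpFeasible κ b α C xb t i) v

/-- The right-hand side of the closed loop when agent `i` applies `u_i(x̄_k,t)`, with `k = κ i`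
its group. -/
def closedLoop (κ : Fin M → Fin K)
    (u : (i : Fin M) → S.GroupState κ (κ i) → ℝ → EuclideanSpace ℝ (Fin (S.m i)))
    (x : S.State) (t : ℝ) : S.State :=
  WithLp.toLp 2 fun i =>
    S.f i (x i) t + Matrix.toEuclideanLin (S.g i (x i) t) (u i (S.groupProj κ (κ i) x) t)
      + S.c i x t

end MultiAgentSystem

end

/-!
Fix a group `k`, a switch interval `[s, s')` and write `𝔟` for the barrier function of the group.

*The programs are solvable.* The feasible set of an agent is closed and convex. If the partial
gradient `p` is nonzero, the full row rank of `g` gives a feasible input. If `p = 0`, then either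
the load share vanishes, or the whole gradient vanishes and the inequality `∂𝔟/∂t > -α(𝔟)` holds;
in both cases every input is feasible. A nonempty closed convex set has exactly one point of
minimum norm.

*The barrier inequality survives Filippov's regularization.* The load shares add up to one, so the
constraints of the agents of the group sum up to `⟨∇𝔟, ẋ⟩ + ∂𝔟/∂t + α(𝔟) ≥ 0` at every point of
`D`. The control law is in general discontinuous, but locally bounded where `∇𝔟 ≠ 0`: there an
approximate right inverse of `g` yields a feasible input of bounded size, because the right-hand
side of the constraint is of order `‖p‖`. Hence near such a point the inequality holds, up to an
arbitrarily small error, with the gradient taken at the point itself, that is, on a closed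
half-space, which then contains the values of Filippov's map. Where `∇𝔟 = 0` the inequality is an
assumption. See `neg_le_inner_gradient_add_deriv_of_mem_filippovMap`.

*Invariance.* Along a solution `𝔟` is absolutely continuous on compact subintervals of `(s, s')`
and continuous at `s`. After a last time in the safe set the solution remains in the open set `D`
for a while, and there `𝔟 < 0` forces `𝔟' ≥ -α(𝔟) > 0` almost everywhere, so `𝔟` cannot become
negative (`nonneg_along_curve`). Since removing functions only decreases the sum of exponentials,
the safe set is not left at the end of a switch interval either, and invariance propagates to the
next one.

*Satisfaction.* In the safe set every active `𝔟ₗ` is nonnegative, by continuity also at its removal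
time `bₗ`. As `𝔟ₗ` lies below the function of its literal at the relevant times, the literals, and
with them the formula, hold.
-/

open Filter Topology

/-! ### Absolutely continuous functions and Filippov's map -/


theorem LipschitzOnWith.comp_absolutelyContinuousOnInterval {X Y : Type*} [PseudoMetricSpace X]
    [PseudoMetricSpace Y] {K : NNReal} {g : X → Y} {s : Set X} {f : ℝ → X} {a b : ℝ}
    (hg : LipschitzOnWith K g s) (hf : AbsolutelyContinuousOnInterval f a b)
    (hfs : MapsTo f (uIcc a b) s) : AbsolutelyContinuousOnInterval (g ∘ f) a b := by
  rw [absolutelyContinuousOnInterval_iff] at hf ⊢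
  intro ε hε
  obtain ⟨δ, hδ, H⟩ := hf (ε / (K + 1)) (by positivity)
  refine ⟨δ, hδ, fun I hI hlen => ?_⟩
  have hI' := H I hI hlen
  calc ∑ i ∈ Finset.range I.1, dist ((g ∘ f) (I.2 i).1) ((g ∘ f) (I.2 i).2)
      ≤ ∑ i ∈ Finset.range I.1, (K + 1) * dist (f (I.2 i).1) (f (I.2 i).2) := by
        refine Finset.sum_le_sum fun i hi => ?_
        have h := hg.dist_le_mul _ (hfs (hI.1 i hi).1) _ (hfs (hI.1 i hi).2)
        have h0 : 0 ≤ dist (f (I.2 i).1) (f (I.2 i).2) := dist_nonneg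
        simp only [Function.comp]
        linarith
    _ = (K + 1) * ∑ i ∈ Finset.range I.1, dist (f (I.2 i).1) (f (I.2 i).2) :=
        (Finset.mul_sum _ _ _).symm
    _ < (K + 1) * (ε / (K + 1)) := by gcongr
    _ = ε := by field_simp

theorem AbsolutelyContinuousOnInterval.prodMk {X Y : Type*} [PseudoMetricSpace X]
    [PseudoMetricSpace Y] {f : ℝ → X} {g : ℝ → Y} {a b : ℝ}
    (hf : AbsolutelyContinuousOnInterval f a b) (hg : AbsolutelyContinuousOnInterval g a b) :
    AbsolutelyContinuousOnInterval (fun t => (f t, g t)) a b := by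
  apply squeeze_zero (fun t ↦ ?_) (fun t ↦ ?_) (by simpa using Tendsto.add hf hg)
  · exact Finset.sum_nonneg fun i hi ↦ dist_nonneg
  · rw [← Finset.sum_add_distrib]
    gcongr
    exact max_le_add_of_nonneg dist_nonneg dist_nonneg

theorem AbsolutelyContinuousOnInterval.le_of_ae_deriv_nonneg {f : ℝ → ℝ} {a b : ℝ} (hab : a ≤ b)
    (hf : AbsolutelyContinuousOnInterval f a b)
    (h : ∀ᵐ t, t ∈ Ioo a b → 0 ≤ deriv f t) : f a ≤ f b := by
  rw [← sub_nonneg, ← hf.integral_deriv_eq_sub]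
  refine intervalIntegral.integral_nonneg_of_ae_restrict hab ?_
  rw [← restrict_Ioo_eq_restrict_Icc]
  exact (ae_restrict_iff' measurableSet_Ioo).2 h

/-- Closed half-spaces that eventually contain the values of the vector field contain the
values of Filippov's map. -/
theorem le_apply_of_mem_filippovMap {E : Type} [NormedAddCommGroup E] [NormedSpace ℝ E]
    [MeasureSpace E] {X : E → ℝ → E} {x v : E} {t : ℝ} (hv : v ∈ filippovMap X x t)
    (L : E →L[ℝ] ℝ) {c : ℝ} (h : ∀ ε > 0, ∀ᶠ y in 𝓝 x, c - ε ≤ L (X y t)) : c ≤ L v := by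
  refine le_of_forall_pos_le_add fun ε hε => ?_
  obtain ⟨δ, hδ, H⟩ := Metric.eventually_nhds_iff_ball.1 (h ε hε)
  simp only [filippovMap, mem_iInter] at hv
  have hv' := hv δ hδ ∅ measure_empty
  have hsub : closure (convexHull ℝ ((fun y => X y t) '' (Metric.ball x δ \ ∅))) ⊆
      {w | c - ε ≤ L w} := by
    refine closure_minimal (convexHull_min ?_ ?_) (isClosed_le continuous_const L.continuous)
    · rintro _ ⟨y, hy, rfl⟩
      exact H y hy.1
    · exact convex_halfSpace_ge L.toLinearMap.isLinear _
  have := hsub hv'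
  simp only [mem_ofPred_eq] at this
  linarith

/-- A continuous function that starts nonnegative stays nonnegative if, whenever it becomes
negative right after a time `a`, its values shortly after `a` are bounded above by a later value. -/
theorem nonneg_of_forall_exists_le {z : ℝ → ℝ} {s τ : ℝ} (hsτ : s ≤ τ)
    (hz : ContinuousOn z (Icc s τ)) (h0 : 0 ≤ z s)
    (H : ∀ a ∈ Ico s τ, 0 ≤ z a → (∀ t ∈ Ioc a τ, z t < 0) →
      ∃ b ∈ Ioc a τ, ∀ c ∈ Ioo a b, z c ≤ z b) : 0 ≤ z τ := by
  by_contra! hneg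
  have hcomp : IsCompact (Icc s τ ∩ z ⁻¹' Ici 0) :=
    isCompact_Icc.of_isClosed_subset (hz.preimage_isClosed_of_isClosed isClosed_Icc isClosed_Ici)
      inter_subset_left
  obtain ⟨a, ⟨haI, hza⟩, hmax⟩ := hcomp.exists_isGreatest ⟨s, left_mem_Icc.2 hsτ, h0⟩
  have haτ : a < τ := by
    refine lt_of_le_of_ne haI.2 ?_
    rintro rfl
    exact absurd hza (by simpa using hneg)
  have hafter : ∀ t ∈ Ioc a τ, z t < 0 := by
    intro t ht
    by_contra! hzt
    exact absurd (hmax ⟨⟨haI.1.trans ht.1.le, ht.2⟩, hzt⟩) (not_le.2 ht.1)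
  obtain ⟨b, hb, hle⟩ := H a ⟨haI.1, haτ⟩ hza hafter
  have hcont : Tendsto z (𝓝[>] a) (𝓝 (z a)) := by
    have h1 : ContinuousWithinAt z (Icc a τ) a :=
      (hz a haI).mono (Icc_subset_Icc haI.1 le_rfl)
    refine h1.tendsto.mono_left ?_
    rw [← nhdsWithin_Ioc_eq_nhdsGT haτ]
    exact nhdsWithin_mono _ Ioc_subset_Icc_self
  have hev : ∀ᶠ c in 𝓝[>] a, z c ≤ z b := by
    filter_upwards [Ioo_mem_nhdsGT hb.1] with c hc using hle c hc
  have h1 := le_of_tendsto hcont hev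
  have h2 := hafter b hb
  have h3 : 0 ≤ z a := hza
  linarith

/-! ### Partial derivatives -/

section PartialDerivatives

variable {E : Type*} [NormedAddCommGroup E] {F : E → ℝ → ℝ} {s s' t : ℝ}

theorem hasFDerivAt_left [NormedSpace ℝ E] {y : E}
    (hF : DifferentiableAt ℝ (fun p : E × ℝ => F p.1 p.2) (y, t)) :
    HasFDerivAt (fun y => F y t)
      ((fderiv ℝ (fun p : E × ℝ => F p.1 p.2) (y, t)).comp (ContinuousLinearMap.inl ℝ E ℝ)) y :=
  HasFDerivAt.comp (f := fun y : E => (y, t)) y hF.hasFDerivAt (hasFDerivAt_prodMk_left y t)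

theorem hasDerivAt_right [NormedSpace ℝ E] {y : E}
    (hF : DifferentiableAt ℝ (fun p : E × ℝ => F p.1 p.2) (y, t)) :
    HasDerivAt (fun τ => F y τ) (fderiv ℝ (fun p : E × ℝ => F p.1 p.2) (y, t) (0, 1)) t :=
  hF.hasFDerivAt.comp_hasDerivAt t ((hasDerivAt_const t y).prodMk (hasDerivAt_id t))

theorem ContDiffOn.differentiableAt_strip [NormedSpace ℝ E]
    (hF : ContDiffOn ℝ 1 (fun p : E × ℝ => F p.1 p.2) (univ ×ˢ Ioo s s')) (ht : t ∈ Ioo s s')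
    (y : E) : DifferentiableAt ℝ (fun p : E × ℝ => F p.1 p.2) (y, t) :=
  (hF.differentiableOn one_ne_zero).differentiableAt
    ((isOpen_univ.prod isOpen_Ioo).mem_nhds ⟨mem_univ _, ht⟩)

theorem ContDiffOn.continuous_fderiv_strip [NormedSpace ℝ E]
    (hF : ContDiffOn ℝ 1 (fun p : E × ℝ => F p.1 p.2) (univ ×ˢ Ioo s s')) (ht : t ∈ Ioo s s') :
    Continuous fun y => fderiv ℝ (fun p : E × ℝ => F p.1 p.2) (y, t) :=
  (hF.continuousOn_fderiv_of_isOpen (isOpen_univ.prod isOpen_Ioo) le_rfl).comp_continuous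
    (by fun_prop) fun _ => ⟨mem_univ _, ht⟩

theorem ContDiffOn.continuous_strip [NormedSpace ℝ E]
    (hF : ContDiffOn ℝ 1 (fun p : E × ℝ => F p.1 p.2) (univ ×ˢ Ioo s s')) (ht : t ∈ Ioo s s') :
    Continuous fun y => F y t :=
  hF.continuousOn.comp_continuous (f := fun y : E => (y, t)) (by fun_prop)
    fun _ => ⟨mem_univ _, ht⟩

theorem ContDiffOn.continuous_deriv_strip [NormedSpace ℝ E]
    (hF : ContDiffOn ℝ 1 (fun p : E × ℝ => F p.1 p.2) (univ ×ˢ Ioo s s')) (ht : t ∈ Ioo s s') :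
    Continuous fun y => deriv (fun τ => F y τ) t := by
  have : (fun y => deriv (fun τ => F y τ) t) =
      fun y => fderiv ℝ (fun p : E × ℝ => F p.1 p.2) (y, t) (0, 1) := by
    funext y
    exact (hasDerivAt_right (hF.differentiableAt_strip ht y)).deriv
  rw [this]
  exact (hF.continuous_fderiv_strip ht).clm_apply continuous_const

theorem ContDiffOn.continuous_gradient_strip [InnerProductSpace ℝ E] [CompleteSpace E]
    (hF : ContDiffOn ℝ 1 (fun p : E × ℝ => F p.1 p.2) (univ ×ˢ Ioo s s')) (ht : t ∈ Ioo s s') :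
    Continuous (gradient fun y => F y t) := by
  have : (gradient fun y => F y t) = fun y => (InnerProductSpace.toDual ℝ E).symm
      ((fderiv ℝ (fun p : E × ℝ => F p.1 p.2) (y, t)).comp (ContinuousLinearMap.inl ℝ E ℝ)) := by
    funext y
    rw [gradient, (hasFDerivAt_left (hF.differentiableAt_strip ht y)).fderiv]
  rw [this]
  exact (InnerProductSpace.toDual ℝ E).symm.continuous.comp
    ((hF.continuous_fderiv_strip ht).clm_comp continuous_const)

theorem hasDerivAt_along_curve [InnerProductSpace ℝ E] [CompleteSpace E] {y : ℝ → E} {v : E}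
    (hF : DifferentiableAt ℝ (fun p : E × ℝ => F p.1 p.2) (y t, t)) (hy : HasDerivAt y v t) :
    HasDerivAt (fun τ => F (y τ) τ)
      (inner ℝ (gradient (fun y => F y t) (y t)) v + deriv (fun τ => F (y t) τ) t) t := by
  have h := HasFDerivAt.comp_hasDerivAt (f := fun τ => (y τ, τ)) t hF.hasFDerivAt
    (hy.prodMk (hasDerivAt_id t))
  have hsplit : ((v, 1) : E × ℝ) = (v, 0) + (0, 1) := by simp
  rw [hsplit, map_add, ← (hasDerivAt_right hF).deriv] at h
  rw [inner_gradient_left, (hasFDerivAt_left hF).fderiv]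
  exact h

end PartialDerivatives

/-! ### Switching times and the semantics of the formulas -/

namespace BarrierData

variable {E : Type}

/-- The sum `∑ₗ 𝔬ₗ(s) exp (-η 𝔟ₗ(x,t))`, whose indicators are frozen at time `s`. Contrary to
`expSum` it is continuous in time. -/
noncomputable def frozenSum (B : BarrierData E) (s : ℝ) (x : E) (t : ℝ) : ℝ :=
  (B.comps.map fun c => if s < c.2 then Real.exp (-B.η * c.1 x t) else 0).sum
    + B.extra.elim 0 fun e => Real.exp (-B.η * e x t)

theorem frozenSum_self (B : BarrierData E) (x : E) (t : ℝ) : B.frozenSum t x t = B.expSum x t := rfl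

theorem frozenSum_anti (B : BarrierData E) {s s' : ℝ} (hs : s ≤ s') (x : E) (t : ℝ) :
    B.frozenSum s' x t ≤ B.frozenSum s x t := by
  refine add_le_add_left (List.sum_le_sum fun c _ => ?_) _
  split_ifs with h1 h2 h2
  · exact le_rfl
  · exact absurd (hs.trans_lt h1) h2
  · positivity
  · exact le_rfl

theorem exp_le_frozenSum (B : BarrierData E) {s : ℝ} {c : (E → ℝ → ℝ) × ℝ} (hc : c ∈ B.comps)
    (hs : s < c.2) (x : E) (t : ℝ) : Real.exp (-B.η * c.1 x t) ≤ B.frozenSum s x t := by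
  have h1 : Real.exp (-B.η * c.1 x t) ≤
      (B.comps.map fun c => if s < c.2 then Real.exp (-B.η * c.1 x t) else 0).sum := by
    refine List.single_le_sum ?_ _ (List.mem_map.2 ⟨c, hc, by simp [hs]⟩)
    intro r hr
    obtain ⟨d, -, rfl⟩ := List.mem_map.1 hr
    split_ifs <;> positivity
  have h2 : 0 ≤ B.extra.elim 0 fun e => Real.exp (-B.η * e x t) := by
    cases B.extra <;> simp [Real.exp_nonneg]
  unfold frozenSum
  linarith

theorem expSum_nonneg (B : BarrierData E) (x : E) (t : ℝ) : 0 ≤ B.expSum x t := by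
  refine add_nonneg (List.sum_nonneg fun r hr => ?_) ?_
  · obtain ⟨d, -, rfl⟩ := List.mem_map.1 hr
    split_ifs <;> positivity
  · cases B.extra <;> simp [Real.exp_nonneg]

theorem mem_safeSet_iff {B : BarrierData E} (hη : 0 < B.η) {x : E} {t : ℝ} :
    x ∈ B.safeSet t ↔ B.expSum x t ≤ 1 := by
  have h : x ∈ B.safeSet t ↔ 0 ≤ -(1 / B.η) * Real.log (B.expSum x t) := Iff.rfl
  rw [h, ← Real.log_nonpos_iff (B.expSum_nonneg x t), neg_mul, neg_nonneg]
  have : 0 < 1 / B.η := by positivity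
  exact ⟨fun h => by by_contra! h'; exact absurd h (not_le.2 (mul_pos this h')),
    fun h => mul_nonpos_of_nonneg_of_nonpos this.le h⟩

/-- No function is removed during a switch interval. -/
theorem IsSwitchInterval.expSum_eq {B : BarrierData E} {s s' : ℝ} (h : B.IsSwitchInterval s s')
    {t : ℝ} (ht : t ∈ Ico s s') (x : E) : B.expSum x t = B.frozenSum s x t := by
  unfold expSum frozenSum
  congr 2
  refine List.map_congr_left fun c hc => ?_
  have : t < c.2 ↔ s < c.2 :=
    ⟨ht.1.trans_lt, fun hs => ht.2.trans_le (h.2.2 ⟨⟨c, hc, rfl⟩, hs⟩)⟩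
  simp only [this]

theorem IsSwitchInterval.frozenSum_pos {B : BarrierData E} {s s' : ℝ}
    (h : B.IsSwitchInterval s s') (x : E) (t : ℝ) : 0 < B.frozenSum s x t := by
  obtain ⟨⟨⟨c, hc, rfl⟩, hs⟩, -⟩ := h.2
  exact (Real.exp_pos _).trans_le (B.exp_le_frozenSum hc hs x t)

theorem IsSwitchInterval.lt {B : BarrierData E} {s s' : ℝ} (h : B.IsSwitchInterval s s') :
    s < s' := h.2.1.2

theorem IsSwitchInterval.start_nonneg {B : BarrierData E} (hB : ∀ c ∈ B.comps, 0 < c.2)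
    {s s' : ℝ} (h : B.IsSwitchInterval s s') : 0 ≤ s := by
  rcases h.1 with rfl | ⟨c, hc, rfl⟩
  · exact le_rfl
  · exact (hB c hc).le

theorem finite_times (B : BarrierData E) : B.times.Finite := by
  refine ((B.comps.map Prod.snd).toFinset.finite_toSet).subset ?_
  rintro r ⟨c, hc, rfl⟩
  simp only [List.coe_toFinset, mem_ofPred_eq, List.mem_map]
  exact ⟨c, hc, rfl⟩

/-- A time before the last removal lies in a switch interval. -/
theorem exists_isSwitchInterval {B : BarrierData E} {t : ℝ} (ht : 0 ≤ t)
    (hlast : ∃ r ∈ B.times, t < r) : ∃ s s', B.IsSwitchInterval s s' ∧ t ∈ Ico s s' := by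
  obtain ⟨s, hs⟩ := ((B.finite_times.insert 0).inter_of_left (Iic t)).exists_maximal
    ⟨0, mem_insert _ _, ht⟩
  obtain ⟨s', hs'⟩ := (B.finite_times.inter_of_left (Ioi t)).exists_minimal hlast
  refine ⟨s, s', ⟨hs.1.1, ⟨hs'.1.1, hs.1.2.trans_lt hs'.1.2⟩, ?_⟩, hs.1.2, hs'.1.2⟩
  rintro r ⟨hr, hsr⟩
  rcases le_or_gt r t with hrt | hrt
  · exact absurd (hs.2 ⟨mem_insert_of_mem _ hr, hrt⟩ hsr.le) (not_le.2 hsr)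
  · exact le_of_not_gt fun hlt => absurd (hs'.2 ⟨hr, hrt⟩ hlt.le) (not_le.2 hlt)

/-- A positive removal time is the right end point of a switch interval. -/
theorem exists_isSwitchInterval_right {B : BarrierData E} {r : ℝ} (hr : r ∈ B.times)
    (hpos : 0 < r) : ∃ s, B.IsSwitchInterval s r := by
  obtain ⟨s, hs⟩ := ((B.finite_times.insert 0).inter_of_left (Iio r)).exists_maximal
    ⟨0, mem_insert _ _, hpos⟩
  refine ⟨s, hs.1.1, ⟨hr, hs.1.2⟩, ?_⟩
  rintro q ⟨hq, hsq⟩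
  by_contra! hqr
  exact absurd (hs.2 ⟨mem_insert_of_mem _ hq, hqr⟩ hsq.le) (not_le.2 hsq)

theorem continuousOn_frozenSum [TopologicalSpace E] {B : BarrierData E}
    (hB : ∀ c ∈ B.comps, ContinuousOn (fun p : E × ℝ => c.1 p.1 p.2) (univ ×ˢ Ici 0))
    (he : ∀ e ∈ B.extra, ContinuousOn (fun p : E × ℝ => e p.1 p.2) (univ ×ˢ Ici 0)) (s : ℝ) :
    ContinuousOn (fun p : E × ℝ => B.frozenSum s p.1 p.2) (univ ×ˢ Ici 0) := by
  refine ContinuousOn.add ?_ ?_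
  · refine continuousOn_list_sum B.comps fun c hc => ?_
    split_ifs
    · exact Real.continuous_exp.comp_continuousOn (continuousOn_const.mul (hB c hc))
    · exact continuousOn_const
  · cases h : B.extra with
    | none => exact continuousOn_const
    | some e =>
      exact Real.continuous_exp.comp_continuousOn (continuousOn_const.mul (he e (by simp [h])))

section Curve

variable [TopologicalSpace E] {B : BarrierData E} {y : ℝ → E} {T : ℝ}

theorem continuousOn_frozenSum_curve
    (hB : ∀ c ∈ B.comps, ContinuousOn (fun p : E × ℝ => c.1 p.1 p.2) (univ ×ˢ Ici 0))
    (he : ∀ e ∈ B.extra, ContinuousOn (fun p : E × ℝ => e p.1 p.2) (univ ×ˢ Ici 0))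
    (hy : ContinuousOn y (Icc 0 T)) (s : ℝ) :
    ContinuousOn (fun t => B.frozenSum s (y t) t) (Icc 0 T) :=
  (continuousOn_frozenSum hB he s).comp (hy.prodMk continuousOn_id)
    fun _ ht => ⟨mem_univ _, ht.1⟩

/-- The safe set is not left when functions are removed: the left limit of the sum of
exponentials is at most `1`, and the removal makes the sum smaller. -/
theorem IsSwitchInterval.mem_safeSet_right (hη : 0 < B.η)
    (hB : ∀ c ∈ B.comps, ContinuousOn (fun p : E × ℝ => c.1 p.1 p.2) (univ ×ˢ Ici 0))
    (he : ∀ e ∈ B.extra, ContinuousOn (fun p : E × ℝ => e p.1 p.2) (univ ×ˢ Ici 0))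
    (hy : ContinuousOn y (Icc 0 T)) {s s' : ℝ} (h : B.IsSwitchInterval s s') (hs : 0 ≤ s)
    (hT : s' ≤ T) (hsafe : ∀ t ∈ Ico s s', y t ∈ B.safeSet t) : y s' ∈ B.safeSet s' := by
  have hle : B.frozenSum s (y s') s' ≤ 1 := by
    have hc := (continuousOn_frozenSum_curve hB he hy s).mono (Icc_subset_Icc hs hT)
    refine ContinuousWithinAt.closure_le (f := fun t => B.frozenSum s (y t) t) (g := fun _ => 1)
      (s := Ico s s') ?_ ((hc s' (right_mem_Icc.2 h.lt.le)).mono Ico_subset_Icc_self)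
      continuousWithinAt_const fun t ht => ?_
    · rw [closure_Ico h.lt.ne]
      exact right_mem_Icc.2 h.lt.le
    · rw [← h.expSum_eq ht]
      exact (mem_safeSet_iff hη).1 (hsafe t ht)
  rw [mem_safeSet_iff hη, ← frozenSum_self]
  exact (B.frozenSum_anti h.lt.le _ _).trans hle

/-- Invariance on each switch interval gives invariance up to the last removal. -/
theorem mem_safeSet_of_switch_invariant (hη : 0 < B.η) (hpos : ∀ c ∈ B.comps, 0 < c.2)
    (hB : ∀ c ∈ B.comps, ContinuousOn (fun p : E × ℝ => c.1 p.1 p.2) (univ ×ˢ Ici 0))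
    (he : ∀ e ∈ B.extra, ContinuousOn (fun p : E × ℝ => e p.1 p.2) (univ ×ˢ Ici 0))
    (hy : ContinuousOn y (Icc 0 T))
    (hinv : ∀ s s', B.IsSwitchInterval s s' → y s ∈ B.safeSet s →
      ∀ t ∈ Ico s s', t ≤ T → y t ∈ B.safeSet t)
    (h0 : y 0 ∈ B.safeSet 0) {s s' : ℝ} (h : B.IsSwitchInterval s s') :
    ∀ t ∈ Ico s s', t ≤ T → y t ∈ B.safeSet t := by
  suffices hstart : ∀ r ∈ B.times, r ≤ T → y r ∈ B.safeSet r by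
    intro t ht htT
    refine hinv s s' h ?_ t ht htT
    rcases h.1 with rfl | hs
    · exact h0
    · exact hstart s hs (ht.1.trans htT)
  intro r hr
  refine B.finite_times.wellFoundedOn (r := (· < ·)) |>.induction hr
    (P := fun r => r ≤ T → y r ∈ B.safeSet r) fun r hr ih hrT => ?_
  obtain ⟨q, hq⟩ : ∃ q, B.IsSwitchInterval q r := by
    obtain ⟨c, hc, rfl⟩ := id hr
    exact exists_isSwitchInterval_right hr (hpos c hc)
  refine hq.mem_safeSet_right hη hB he hy (hq.start_nonneg hpos) hrT fun t ht =>
    hinv q r hq ?_ t ht (ht.2.le.trans hrT)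
  rcases hq.1 with rfl | hqt
  · exact h0
  · exact ih q hqt hq.lt (hq.lt.le.trans hrT)

/-- Each function is nonnegative along the curve up to, and including, its removal time. -/
theorem comp_nonneg_of_mem_safeSet (hη : 0 < B.η) (hpos : ∀ c ∈ B.comps, 0 < c.2)
    (hB : ∀ c ∈ B.comps, ContinuousOn (fun p : E × ℝ => c.1 p.1 p.2) (univ ×ˢ Ici 0))
    (hy : ContinuousOn y (Icc 0 T))
    (hsafe : ∀ s s', B.IsSwitchInterval s s' → ∀ t ∈ Ico s s', t ≤ T → y t ∈ B.safeSet t)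
    {c : (E → ℝ → ℝ) × ℝ} (hc : c ∈ B.comps) (hcT : c.2 ≤ T) :
    ∀ t ∈ Icc 0 c.2, 0 ≤ c.1 (y t) t := by
  have hcont : ContinuousOn (fun t => c.1 (y t) t) (Icc 0 c.2) :=
    (hB c hc).comp ((hy.mono (Icc_subset_Icc_right hcT)).prodMk continuousOn_id)
      fun _ ht => ⟨mem_univ _, ht.1⟩
  have hIco : ∀ t ∈ Ico 0 c.2, 0 ≤ c.1 (y t) t := by
    intro t ht
    obtain ⟨s, s', h, hts⟩ := B.exists_isSwitchInterval ht.1 ⟨c.2, ⟨c, hc, rfl⟩, ht.2⟩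
    have h1 := (mem_safeSet_iff hη).1 (hsafe s s' h t hts (ht.2.le.trans hcT))
    have h2 := (B.exp_le_frozenSum hc ht.2 (y t) t).trans h1
    rw [Real.exp_le_one_iff, neg_mul, neg_nonpos] at h2
    exact nonneg_of_mul_nonneg_right h2 hη
  intro t ht
  have hcl : t ∈ closure (Ico 0 c.2) := by rwa [closure_Ico (hpos c hc).ne]
  exact ContinuousWithinAt.closure_le (f := fun _ => (0 : ℝ)) (g := fun t => c.1 (y t) t)
    hcl continuousWithinAt_const
    ((hcont t ht).mono Ico_subset_Icc_self) hIco

end Curve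

end BarrierData

theorem EncodesPhi.removal_pos {E : Type} [NormedAddCommGroup E] [NormedSpace ℝ E]
    {r : UntilConvention} {φ : PhiFormula E} {L : List ((E → ℝ → ℝ) × ℝ)}
    (hL : EncodesPhi r φ L) (hφ : φ.WellFormed) : ∀ c ∈ L, 0 < c.2 := by
  induction φ generalizing L with
  | alw a b ψ =>
    obtain ⟨L₁, rfl, -⟩ := hL
    intro c hc
    obtain ⟨f, -, rfl⟩ := List.mem_map.1 hc
    exact hφ.1.2.2
  | ev a b ψ =>
    obtain ⟨L₁, rfl, -⟩ := hL
    intro c hc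
    obtain ⟨f, -, rfl⟩ := List.mem_map.1 hc
    exact hφ.1.2.2
  | untl a b ψ ψ' =>
    obtain ⟨L₁, L₂, rfl, -⟩ := hL
    intro c hc
    obtain ⟨f, -, rfl⟩ := List.mem_map.1 hc
    exact hφ.1.2.2
  | and φ φ' ih ih' =>
    obtain ⟨L₁, L₂, rfl, h1, h2⟩ := hL
    intro c hc
    rcases List.mem_append.1 hc with hc | hc
    · exact ih h1 hφ.1 c hc
    · exact ih' h2 hφ.2 c hc

theorem EncodesPsi.sat {E : Type} {r : UntilConvention} {x : ℝ → E} {S : Set ℝ} {t : ℝ}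
    (ht : t ∈ S) {ψ : PsiFormula E} {L : List (E → ℝ → ℝ)} (hL : EncodesPsi S ψ L)
    (hx : ∀ f ∈ L, 0 ≤ f (x t) t) : ψ.toSTL.Sat r x t := by
  induction ψ generalizing L with
  | tt => trivial
  | pred h =>
    obtain ⟨b, rfl, hb⟩ := hL
    exact (hx b (by simp)).trans (hb t ht _)
  | negPred h =>
    obtain ⟨b, rfl, hb⟩ := hL
    have h1 := hx b (by simp)
    have h2 := hb t ht (x t)
    change ¬ 0 ≤ h (x t)
    linarith
  | and ψ ψ' ih ih' =>
    obtain ⟨L₁, L₂, rfl, h1, h2⟩ := hL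
    exact ⟨ih h1 fun f hf => hx f (List.mem_append_left _ hf),
      ih' h2 fun f hf => hx f (List.mem_append_right _ hf)⟩

theorem EncodesPhi.sat {E : Type} [NormedAddCommGroup E] [NormedSpace ℝ E]
    {r : UntilConvention} {x : ℝ → E} {φ : PhiFormula E} {L : List ((E → ℝ → ℝ) × ℝ)} {T : ℝ}
    (hL : EncodesPhi r φ L) (hφ : φ.WellFormed) (hT : φ.horizon ≤ T)
    (hx : ∀ c ∈ L, c.2 ≤ T → ∀ t ∈ Icc 0 c.2, 0 ≤ c.1 (x t) t) : φ.toSTL.Sat r x 0 := by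
  induction φ generalizing L with
  | alw a b ψ =>
    obtain ⟨L₁, rfl, h1⟩ := hL
    rintro ⟨t, ht, hneg, -⟩
    rw [zero_add, zero_add] at ht
    exact hneg (h1.sat ht fun f hf =>
      hx (f, b) (List.mem_map_of_mem hf) hT t ⟨hφ.1.1.trans ht.1, ht.2⟩)
  | ev a b ψ =>
    obtain ⟨L₁, rfl, t, ht, h1⟩ := hL
    refine ⟨t, by simpa using ht, h1.sat (mem_singleton t) fun f hf => ?_, fun _ _ => trivial⟩
    exact hx (f, b) (List.mem_map_of_mem hf) hT t ⟨hφ.1.1.trans ht.1, ht.2⟩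
  | untl a b ψ ψ' =>
    obtain ⟨L₁, L₂, rfl, t, ht, h2, h1⟩ := hL
    refine ⟨t, by simpa using ht, h2.sat (mem_singleton t) fun f hf => ?_, fun τ hτ => ?_⟩
    · exact hx (f, b) (List.mem_map_of_mem (List.mem_append_right _ hf)) hT t
        ⟨hφ.1.1.trans ht.1, ht.2⟩
    · rw [zero_add] at hτ
      have hstart : 0 ≤ r.start a := by
        cases r
        · exact le_rfl
        · exact hφ.1.1
      exact h1.sat hτ fun f hf => hx (f, b) (List.mem_map_of_mem (List.mem_append_left _ hf)) hT τ
        ⟨hstart.trans hτ.1, hτ.2.trans ht.2⟩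
  | and φ φ' ih ih' =>
    obtain ⟨L₁, L₂, rfl, h1, h2⟩ := hL
    exact ⟨ih h1 hφ.1 ((le_max_left _ _).trans hT) fun c hc => hx c (List.mem_append_left _ hc),
      ih' h2 hφ.2 ((le_max_right _ _).trans hT) fun c hc => hx c (List.mem_append_right _ hc)⟩

/-! ### Minimum norm points and right inverses -/

theorem IsClosed.existsUnique_isMinOn_inner_self {H : Type*} [NormedAddCommGroup H]
    [InnerProductSpace ℝ H] [CompleteSpace H] {A : Set H} (hcl : IsClosed A) (hA : Convex ℝ A)
    (hne : A.Nonempty) : ∃! v, v ∈ A ∧ IsMinOn (fun w => inner ℝ w w) A v := by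
  have hiff : ∀ v ∈ A, IsMinOn (fun w : H => inner ℝ w w) A v ↔ ∀ w ∈ A, ‖v‖ ≤ ‖w‖ := by
    intro v _
    refine forall₂_congr fun w _ => ?_
    simp only [mem_ofPred_eq, real_inner_self_eq_norm_sq]
    exact sq_le_sq₀ (norm_nonneg _) (norm_nonneg _)
  have hinf : ∀ v ∈ A, (∀ w ∈ A, ‖v‖ ≤ ‖w‖) → ‖(0 : H) - v‖ = ⨅ w : A, ‖(0 : H) - w‖ := by
    intro v hv hmin
    have : Nonempty A := ⟨⟨v, hv⟩⟩
    refine le_antisymm (le_ciInf fun w => by simpa using hmin w w.2) ?_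
    exact ciInf_le ⟨0, by rintro _ ⟨w, rfl⟩; positivity⟩ (⟨v, hv⟩ : A)
  obtain ⟨v, hv, hvmin⟩ := exists_norm_eq_iInf_of_complete_convex hne hcl.isComplete hA 0
  have hvmin' : ∀ w ∈ A, ‖v‖ ≤ ‖w‖ := by
    intro w hw
    have h := ciInf_le (f := fun w : A => ‖(0 : H) - w‖)
      ⟨0, by rintro _ ⟨w, rfl⟩; positivity⟩ ⟨w, hw⟩
    rw [← hvmin] at h
    simpa using h
  refine ⟨v, ⟨hv, (hiff v hv).2 hvmin'⟩, ?_⟩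
  rintro w ⟨hw, hwmin⟩
  have hwmin' := (hiff w hw).1 hwmin
  -- the variational inequalities of both minimizers, tested against each other
  have h1 := (norm_eq_iInf_iff_real_inner_le_zero hA hv).1 (hinf v hv hvmin') w hw
  have h2 := (norm_eq_iInf_iff_real_inner_le_zero hA hw).1 (hinf w hw hwmin') v hv
  have h3 : inner ℝ (w - v) (w - v) ≤ 0 := by
    have : inner ℝ (w - v) (w - v) =
        inner ℝ ((0 : H) - v) (w - v) + inner ℝ ((0 : H) - w) (v - w) := by
      simp only [inner_sub_left, inner_sub_right, inner_zero_left]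
      ring
    linarith
  rwa [real_inner_self_nonpos, sub_eq_zero] at h3

theorem Matrix.exists_rightInverse_toEuclideanLin {n m : ℕ} {A : Matrix (Fin n) (Fin m) ℝ}
    (hA : A.rank = n) : ∃ R : EuclideanSpace ℝ (Fin n) →L[ℝ] EuclideanSpace ℝ (Fin m),
      ∀ z, A.toEuclideanLin (R z) = z := by
  have hsurj : LinearMap.range A.toEuclideanLin = ⊤ := by
    refine Submodule.eq_top_of_finrank_eq ?_
    have h := A.rank_eq_finrank_range_toLin (PiLp.basisFun 2 ℝ _) (PiLp.basisFun 2 ℝ _)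
    rw [← Matrix.toLpLin_eq_toLin] at h
    rw [finrank_euclideanSpace_fin]
    exact h.symm.trans hA
  obtain ⟨R, hR⟩ := LinearMap.exists_rightInverse_of_surjective _ hsurj
  exact ⟨LinearMap.toContinuousLinearMap R, fun z => LinearMap.congr_fun hR z⟩

/-! ### The quadratic programs at a single point -/

namespace MultiAgentSystem

variable {M K : ℕ} (S : MultiAgentSystem M) {κ : Fin M → Fin K} {k : Fin K}
  {b : S.GroupState κ k → ℝ → ℝ} {xb : S.GroupState κ k} {t C : ℝ} {α : ℝ → ℝ}

theorem norm_mul_le_norm_mul_nHat_mul (i : {i : Fin M // κ i = k})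
    (p : EuclideanSpace ℝ (Fin (S.n i))) {a : ℝ} (ha : 0 ≤ a) :
    ‖p‖ * a ≤ ‖p‖ * S.nHat κ k * a := by
  rcases eq_or_ne p 0 with rfl | hp
  · simp
  have hn : 1 ≤ S.n i := by
    by_contra! h
    have h0 : S.n i = 0 := by omega
    refine hp (PiLp.ext fun j => ?_)
    exact absurd j.2 (by omega)
  have h1 : (1 : ℝ) ≤ ∑ i : {i : Fin M // κ i = k}, (S.n i : ℝ) :=
    le_trans (by exact_mod_cast hn) (Finset.single_le_sum (f := fun i : {i // κ i = k} =>
      (S.n i : ℝ)) (fun j _ => Nat.cast_nonneg _) (Finset.mem_univ i))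
  have h2 : (1 : ℝ) ≤ ((Finset.univ.sup S.n : ℕ) : ℝ) := by
    exact_mod_cast hn.trans (Finset.le_sup (f := S.n) (Finset.mem_univ i.1))
  have h3 : 1 ≤ S.nHat κ k := Real.one_le_sqrt.2 (one_le_mul_of_one_le_of_one_le h1 h2)
  refine mul_le_mul_of_nonneg_right ?_ ha
  exact le_mul_of_one_le_right (norm_nonneg p) h3

theorem sum_norm_partialGrad_eq_zero_iff :
    ∑ d, ‖S.partialGrad κ b xb t d‖ = 0 ↔ gradient (fun y => b y t) xb = 0 := by
  rw [Finset.sum_eq_zero_iff_of_nonneg fun _ _ => norm_nonneg _]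
  constructor
  · intro h
    refine PiLp.ext fun i => ?_
    exact norm_eq_zero.1 (h i (Finset.mem_univ i))
  · intro h i _
    simp [partialGrad, h]

theorem sum_norm_partialGrad_nonneg : 0 ≤ ∑ d, ‖S.partialGrad κ b xb t d‖ :=
  Finset.sum_nonneg fun _ _ => norm_nonneg _

theorem loadShare_of_gradient_ne_zero (h : gradient (fun y => b y t) xb ≠ 0)
    (i : {i : Fin M // κ i = k}) : S.loadShare κ b xb t i =
      ‖S.partialGrad κ b xb t i‖ / ∑ d, ‖S.partialGrad κ b xb t d‖ :=
  if_pos (mt S.sum_norm_partialGrad_eq_zero_iff.1 h)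

theorem loadShare_of_gradient_eq_zero (h : gradient (fun y => b y t) xb = 0)
    (i : {i : Fin M // κ i = k}) : S.loadShare κ b xb t i = 1 :=
  if_neg (not_not.2 (S.sum_norm_partialGrad_eq_zero_iff.2 h))

theorem nonempty_qpFeasible (i : {i : Fin M // κ i = k}) (hrank : (S.g i (xb i) t).rank = S.n i)
    (hgrad : gradient (fun y => b y t) xb = 0 → -α (b xb t) < deriv (fun τ => b xb τ) t) :
    (S.qpFeasible κ b α C xb t i).Nonempty := by
  obtain ⟨R, hR⟩ := Matrix.exists_rightInverse_toEuclideanLin hrank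
  set p := S.partialGrad κ b xb t i with hp
  set l := ‖p‖ * S.nHat κ k * C -
    S.loadShare κ b xb t i * (deriv (fun s => b xb s) t + α (b xb t)) with hl
  rcases eq_or_ne p 0 with h0 | h0
  · refine ⟨0, ?_⟩
    change l ≤ inner ℝ p _
    rw [h0, inner_zero_left, hl, h0, norm_zero, zero_mul, zero_mul, zero_sub, neg_nonpos]
    rcases eq_or_ne (gradient (fun y => b y t) xb) 0 with hg | hg
    · rw [S.loadShare_of_gradient_eq_zero hg, one_mul]
      linarith [hgrad hg]
    · rw [S.loadShare_of_gradient_ne_zero hg, ← hp, h0, norm_zero, zero_div, zero_mul]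
  · refine ⟨((l - inner ℝ p (S.f i (xb i) t)) / ‖p‖ ^ 2) • R p, ?_⟩
    change l ≤ inner ℝ p _
    have hn : ‖p‖ ≠ 0 := norm_ne_zero_iff.2 h0
    rw [map_smul, hR, inner_add_right, inner_smul_right, real_inner_self_eq_norm_sq,
      div_mul_cancel₀ _ (pow_ne_zero 2 hn)]
    linarith

theorem existsUnique_isQPSolution (i : {i : Fin M // κ i = k})
    (hrank : (S.g i (xb i) t).rank = S.n i)
    (hgrad : gradient (fun y => b y t) xb = 0 → -α (b xb t) < deriv (fun τ => b xb τ) t) :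
    ∃! v, S.IsQPSolution κ b α C xb t i v := by
  set L := (innerSL ℝ (S.partialGrad κ b xb t i)).comp
    (LinearMap.toContinuousLinearMap (S.g i (xb i) t).toEuclideanLin) with hL
  have hset : S.qpFeasible κ b α C xb t i = {v | ‖S.partialGrad κ b xb t i‖ * S.nHat κ k * C
        - S.loadShare κ b xb t i * (deriv (fun s => b xb s) t + α (b xb t))
        - inner ℝ (S.partialGrad κ b xb t i) (S.f i (xb i) t) ≤ L v} := by
    ext v
    have hLv : L v = inner ℝ (S.partialGrad κ b xb t i) ((S.g i (xb i) t).toEuclideanLin v) := rfl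
    simp only [qpFeasible, mem_ofPred_eq, inner_add_right, hLv]
    exact sub_le_iff_le_add'.symm
  refine IsClosed.existsUnique_isMinOn_inner_self ?_ ?_ (S.nonempty_qpFeasible i hrank hgrad)
  · rw [hset]
    exact isClosed_le continuous_const L.continuous
  · rw [hset]
    exact convex_halfSpace_ge L.toLinearMap.isLinear _

/-- The sum of the constraints of all agents of a group bounds the derivative of the barrier
function from below, since the load shares add up to one. -/
theorem neg_le_sum_inner_of_mem_qpFeasible (hC : 0 ≤ C)
    (hgrad : gradient (fun y => b y t) xb = 0 → -α (b xb t) < deriv (fun τ => b xb τ) t)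
    {v : (i : {i : Fin M // κ i = k}) → EuclideanSpace ℝ (Fin (S.m i))}
    (hv : ∀ i, v i ∈ S.qpFeasible κ b α C xb t i)
    {c : (i : {i : Fin M // κ i = k}) → EuclideanSpace ℝ (Fin (S.n i))} (hc : ∀ i, ‖c i‖ ≤ C) :
    -(deriv (fun τ => b xb τ) t + α (b xb t)) ≤ ∑ i, inner ℝ (S.partialGrad κ b xb t i)
      (S.f i (xb i) t + (S.g i (xb i) t).toEuclideanLin (v i) + c i) := by
  rcases eq_or_ne (gradient (fun y => b y t) xb) 0 with hg | hg
  · have hz : ∀ i, S.partialGrad κ b xb t i = 0 := fun i => by simp [partialGrad, hg]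
    simp only [hz, inner_zero_left, Finset.sum_const_zero]
    linarith [hgrad hg]
  set W := deriv (fun τ => b xb τ) t + α (b xb t)
  have hshare : ∑ i, S.loadShare κ b xb t i = 1 := by
    simp only [S.loadShare_of_gradient_ne_zero hg, ← Finset.sum_div]
    exact div_self (mt S.sum_norm_partialGrad_eq_zero_iff.1 hg)
  calc -W = ∑ i, -(S.loadShare κ b xb t i * W) := by
        rw [Finset.sum_neg_distrib, ← Finset.sum_mul, hshare, one_mul]
    _ ≤ _ := Finset.sum_le_sum fun i _ => by
        have h1 : ‖S.partialGrad κ b xb t i‖ * S.nHat κ k * C - S.loadShare κ b xb t i * W ≤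
          inner ℝ (S.partialGrad κ b xb t i)
            (S.f i (xb i) t + (S.g i (xb i) t).toEuclideanLin (v i)) := hv i
        have h2 := S.norm_mul_le_norm_mul_nHat_mul i (S.partialGrad κ b xb t i) hC
        have h3 := (abs_le.1 (abs_real_inner_le_norm (S.partialGrad κ b xb t i) (c i))).1
        have h4 := mul_le_mul_of_nonneg_left (hc i) (norm_nonneg (S.partialGrad κ b xb t i))
        rw [inner_add_right]
        linarith

/-! ### Local boundedness of the control law -/

theorem continuous_partialGrad (h : Continuous (gradient fun y => b y t))
    (i : {i : Fin M // κ i = k}) : Continuous fun y => S.partialGrad κ b y t i :=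
  (PiLp.continuous_apply 2 _ i).comp h

/-- The solution is not longer than an explicit feasible input, a multiple of `R p / ‖p‖`, where
`p` is the partial gradient and `R` an approximate right inverse of `g`. The bound does not depend
on `p`, since all terms of the constraint are of order `‖p‖`. -/
theorem norm_le_of_isQPSolution (hC : 0 ≤ C) (i : {i : Fin M // κ i = k})
    {R : EuclideanSpace ℝ (Fin (S.n i)) →L[ℝ] EuclideanSpace ℝ (Fin (S.m i))}
    (hR : ∀ z, ‖(S.g i (xb i) t).toEuclideanLin (R z) - z‖ ≤ 1 / 2 * ‖z‖) {σ W Φ : ℝ} (hσ : 0 < σ)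
    (hsum : σ ≤ ∑ d, ‖S.partialGrad κ b xb t d‖)
    (hW : |deriv (fun τ => b xb τ) t + α (b xb t)| ≤ W) (hΦ : ‖S.f i (xb i) t‖ ≤ Φ)
    {v : EuclideanSpace ℝ (Fin (S.m i))} (hv : S.IsQPSolution κ b α C xb t i v) :
    ‖v‖ ≤ 2 * (S.nHat κ k * C + W / σ + Φ) * ‖R‖ := by
  set p := S.partialGrad κ b xb t i with hp
  set A := S.nHat κ k * C + W / σ + Φ with hA
  have hW0 : 0 ≤ W := (abs_nonneg _).trans hW
  have hΦ0 : 0 ≤ Φ := (norm_nonneg _).trans hΦ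
  have hA0 : 0 ≤ A := by
    have : 0 ≤ S.nHat κ k := Real.sqrt_nonneg _
    positivity
  have hg : gradient (fun y => b y t) xb ≠ 0 := fun h =>
    absurd (S.sum_norm_partialGrad_eq_zero_iff.2 h) (hσ.trans_le hsum).ne'
  -- for `p = 0` this input is `0`, because `2 * A / 0 = 0`
  set w := (2 * A / ‖p‖) • R p with hw
  have hwnorm : ‖w‖ ≤ 2 * A * ‖R‖ := by
    rw [hw, norm_smul, Real.norm_of_nonneg (by positivity)]
    rcases eq_or_ne p 0 with h0 | h0
    · rw [h0]
      simp only [norm_zero, div_zero, zero_mul]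
      positivity
    · have hn : 0 < ‖p‖ := norm_pos_iff.2 h0
      calc 2 * A / ‖p‖ * ‖R p‖ ≤ 2 * A / ‖p‖ * (‖R‖ * ‖p‖) := by
            gcongr
            exact R.le_opNorm p
        _ = 2 * A * ‖R‖ := by field_simp
  have hwfeas : w ∈ S.qpFeasible κ b α C xb t i := by
    change ‖p‖ * S.nHat κ k * C - _ * _ ≤ inner ℝ p _
    rw [S.loadShare_of_gradient_ne_zero hg, ← hp, inner_add_right, hw, map_smul, inner_smul_right]
    have h1 : A * ‖p‖ ≤
        2 * A / ‖p‖ * inner ℝ p ((S.g i (xb i) t).toEuclideanLin (R p)) := by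
      have h2 : 1 / 2 * ‖p‖ ^ 2 ≤ inner ℝ p ((S.g i (xb i) t).toEuclideanLin (R p)) := by
        have h3 : inner ℝ p ((S.g i (xb i) t).toEuclideanLin (R p)) =
            ‖p‖ ^ 2 + inner ℝ p ((S.g i (xb i) t).toEuclideanLin (R p) - p) := by
          rw [inner_sub_right, real_inner_self_eq_norm_sq]
          ring
        have h4 := (abs_le.1 (abs_real_inner_le_norm p
          ((S.g i (xb i) t).toEuclideanLin (R p) - p))).1
        have h5 := mul_le_mul_of_nonneg_left (hR p) (norm_nonneg p)
        nlinarith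
      refine le_trans (le_of_eq ?_) (mul_le_mul_of_nonneg_left h2 (by positivity))
      rcases eq_or_ne p 0 with h0 | h0
      · simp [h0]
      · have hn : ‖p‖ ≠ 0 := norm_ne_zero_iff.2 h0
        field_simp
    have h6 : -(‖p‖ * Φ) ≤ inner ℝ p (S.f i (xb i) t) := by
      have h7 := (abs_le.1 (abs_real_inner_le_norm p (S.f i (xb i) t))).1
      have h8 := mul_le_mul_of_nonneg_left hΦ (norm_nonneg p)
      linarith
    have h9 : -(‖p‖ * (W / σ)) ≤ ‖p‖ / (∑ d, ‖S.partialGrad κ b xb t d‖) *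
        (deriv (fun τ => b xb τ) t + α (b xb t)) := by
      have h10 : |‖p‖ / (∑ d, ‖S.partialGrad κ b xb t d‖) *
          (deriv (fun τ => b xb τ) t + α (b xb t))| ≤ ‖p‖ / σ * W := by
        rw [abs_mul, abs_of_nonneg (by have := hσ.trans_le hsum; positivity)]
        gcongr
      have h11 : ‖p‖ / σ * W = ‖p‖ * (W / σ) := by ring
      linarith [(abs_le.1 h10).1]
    have h12 : A * ‖p‖ = ‖p‖ * S.nHat κ k * C + ‖p‖ * (W / σ) + ‖p‖ * Φ := by
      rw [hA]
      ring
    linarith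
  have hmin : inner ℝ v v ≤ inner ℝ w w := hv.2 hwfeas
  rw [real_inner_self_eq_norm_sq, real_inner_self_eq_norm_sq,
    sq_le_sq₀ (norm_nonneg _) (norm_nonneg _)] at hmin
  exact hmin.trans hwnorm

/-- Near a point where the gradient does not vanish the solutions of the quadratic program are
bounded, although they need not be continuous. -/
theorem exists_eventually_norm_le_of_isQPSolution (hC : 0 ≤ C) (hα : Continuous α)
    (hb : Continuous fun y => b y t) (hbt : Continuous fun y => deriv (fun τ => b y τ) t)
    (hbg : Continuous (gradient fun y => b y t)) (i : {i : Fin M // κ i = k})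
    (hf : Continuous fun z => S.f i z t)
    (hg : Continuous fun z => LinearMap.toContinuousLinearMap (S.g i z t).toEuclideanLin)
    (hrank : (S.g i (xb i) t).rank = S.n i) (hne : gradient (fun y => b y t) xb ≠ 0) :
    ∃ Q, ∀ᶠ y in 𝓝 xb, ∀ v, S.IsQPSolution κ b α C y t i v → ‖v‖ ≤ Q := by
  obtain ⟨R, hR⟩ := Matrix.exists_rightInverse_toEuclideanLin hrank
  have hproj : Continuous fun y : S.GroupState κ k => y i := PiLp.continuous_apply 2 _ i
  have hsum : Continuous fun y => ∑ d, ‖S.partialGrad κ b y t d‖ :=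
    continuous_finsetSum _ fun d _ => (S.continuous_partialGrad hbg d).norm
  have hpos : 0 < ∑ d, ‖S.partialGrad κ b xb t d‖ :=
    lt_of_le_of_ne S.sum_norm_partialGrad_nonneg
      (Ne.symm (mt S.sum_norm_partialGrad_eq_zero_iff.1 hne))
  have hRcont : Continuous fun y : S.GroupState κ k =>
      ‖(LinearMap.toContinuousLinearMap (S.g i (y i) t).toEuclideanLin).comp R -
        ContinuousLinearMap.id ℝ _‖ :=
    (((hg.comp hproj).clm_comp continuous_const).sub continuous_const).norm
  have hR0 : ‖(LinearMap.toContinuousLinearMap (S.g i (xb i) t).toEuclideanLin).comp R -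
      ContinuousLinearMap.id ℝ _‖ < 1 / 2 := by
    have : (LinearMap.toContinuousLinearMap (S.g i (xb i) t).toEuclideanLin).comp R =
        ContinuousLinearMap.id ℝ _ := ContinuousLinearMap.ext hR
    rw [this, sub_self, norm_zero]
    norm_num
  refine ⟨2 * (S.nHat κ k * C + (|deriv (fun τ => b xb τ) t + α (b xb t)| + 1) /
    ((∑ d, ‖S.partialGrad κ b xb t d‖) / 2) + (‖S.f i (xb i) t‖ + 1)) * ‖R‖, ?_⟩
  filter_upwards [hsum.continuousAt.eventually (lt_mem_nhds (half_lt_self hpos)),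
    (hbt.add (hα.comp hb)).abs.continuousAt.eventually (gt_mem_nhds (lt_add_one _)),
    (hf.comp hproj).norm.continuousAt.eventually (gt_mem_nhds (lt_add_one _)),
    hRcont.continuousAt.eventually (gt_mem_nhds hR0)] with y h1 h2 h3 h4 v hv
  refine S.norm_le_of_isQPSolution hC i (R := R) (fun z => ?_) (half_pos hpos) h1.le h2.le h3.le hv
  exact (ContinuousLinearMap.le_opNorm _ z).trans
    (mul_le_mul_of_nonneg_right h4.le (norm_nonneg z))

end MultiAgentSystem

/-! ### Barrier functions along absolutely continuous curves -/

theorem ContDiffOn.absolutelyContinuousOnInterval_along_curve {E : Type*} [NormedAddCommGroup E]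
    [NormedSpace ℝ E] [ProperSpace E] {F : E → ℝ → ℝ} {s s' c d : ℝ}
    (hF : ContDiffOn ℝ 1 (fun p : E × ℝ => F p.1 p.2) (univ ×ˢ Ioo s s'))
    (hc : s < c) (hcd : c ≤ d) (hd : d < s') {y : ℝ → E}
    (hy : AbsolutelyContinuousOnInterval y c d) :
    AbsolutelyContinuousOnInterval (fun τ => F (y τ) τ) c d := by
  have hyc : ContinuousOn y (Icc c d) := uIcc_of_le hcd ▸ hy.continuousOn
  obtain ⟨R, hR⟩ := (isCompact_Icc.image_of_continuousOn hyc).isBounded.subset_closedBall 0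
  have hF' : ContDiffOn ℝ 1 (fun p : E × ℝ => F p.1 p.2) (Metric.closedBall 0 R ×ˢ Icc c d) :=
    hF.mono (prod_mono (subset_univ _) (Icc_subset_Ioo hc hd))
  obtain ⟨K, hK⟩ := hF'.exists_lipschitzOnWith one_ne_zero
    ((convex_closedBall 0 R).prod (convex_Icc c d))
    ((isCompact_closedBall 0 R).prod isCompact_Icc)
  have hid : AbsolutelyContinuousOnInterval (fun τ : ℝ => τ) c d :=
    (LipschitzWith.id.lipschitzOnWith (s := uIcc c d)).absolutelyContinuousOnInterval
  have hmaps : MapsTo (fun τ => (y τ, τ)) (uIcc c d) (Metric.closedBall 0 R ×ˢ Icc c d) := by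
    intro τ hτ
    rw [uIcc_of_le hcd] at hτ
    exact ⟨hR (mem_image_of_mem y hτ), hτ⟩
  have h := LipschitzOnWith.comp_absolutelyContinuousOnInterval (f := fun τ => (y τ, τ)) hK
    (hy.prodMk hid) hmaps
  exact h

/-- Forward invariance of `{0 ≤ F}`: a curve that leaves this set is still in the open set `D`
shortly afterwards, where `F` does not decrease along it as long as it is negative. -/
theorem nonneg_along_curve {E : Type*} [NormedAddCommGroup E]
    [NormedSpace ℝ E] [ProperSpace E] {F : E → ℝ → ℝ} {s s' T : ℝ}
    (hF : ContDiffOn ℝ 1 (fun p : E × ℝ => F p.1 p.2) (univ ×ˢ Ioo s s')) (hs : 0 ≤ s)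
    {y : ℝ → E} (hy : AbsolutelyContinuousOnInterval y 0 T) {D : Set E} (hD : IsOpen D)
    (hsub : ∀ τ ∈ Ico s s', ∀ x, 0 ≤ F x τ → x ∈ D) (h0 : 0 ≤ F (y s) s)
    (hderiv : ∀ᵐ τ, τ ∈ Ioo 0 T → τ ∈ Ioo s s' → y τ ∈ D → F (y τ) τ < 0 →
      0 ≤ deriv (fun τ => F (y τ) τ) τ)
    {t : ℝ} (ht : t ∈ Ico s s') (htT : t ≤ T)
    (hcont : ContinuousOn (fun τ => F (y τ) τ) (Icc s t)) : 0 ≤ F (y t) t := by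
  refine nonneg_of_forall_exists_le (z := fun τ => F (y τ) τ) ht.1 hcont h0 fun a ha hza hneg => ?_
  have ha0 : 0 ≤ a := hs.trans ha.1
  have hT : 0 ≤ T := ha0.trans (ha.2.le.trans htT)
  have hyc : ContinuousOn y (Icc 0 T) := uIcc_of_le hT ▸ hy.continuousOn
  have hyD : y a ∈ D := hsub a ⟨ha.1, ha.2.trans ht.2⟩ _ hza
  have hya : ContinuousWithinAt y (Ioc a t) a :=
    (hyc a ⟨ha0, ha.2.le.trans htT⟩).mono
      (Ioc_subset_Icc_self.trans (Icc_subset_Icc ha0 htT))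
  have hev : ∀ᶠ τ in 𝓝[>] a, y τ ∈ D := by
    rw [← nhdsWithin_Ioc_eq_nhdsGT ha.2]
    exact hya (hD.mem_nhds hyD)
  obtain ⟨e, hae, he⟩ := (mem_nhdsGT_iff_exists_Ioo_subset).1 hev
  have hae : a < e := hae
  refine ⟨min ((a + e) / 2) t, ⟨lt_min (by linarith) ha.2, min_le_right _ _⟩, fun c hc => ?_⟩
  set d := min ((a + e) / 2) t with hd
  have hdt : d ≤ t := min_le_right _ _
  have hde : d < e := (min_le_left _ _).trans_lt (by linarith)
  refine AbsolutelyContinuousOnInterval.le_of_ae_deriv_nonneg (f := fun τ => F (y τ) τ) hc.2.le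
    (hF.absolutelyContinuousOnInterval_along_curve (ha.1.trans_lt hc.1) hc.2.le
      (hdt.trans_lt ht.2) (hy.mono ?_)) ?_
  · rw [uIcc_of_le hc.2.le, uIcc_of_le hT]
    exact Icc_subset_Icc (ha0.trans hc.1.le) (hdt.trans htT)
  · filter_upwards [hderiv] with τ hτ hτI
    have haτ : a < τ := hc.1.trans hτI.1
    have hτt : τ < t := hτI.2.trans_le hdt
    exact hτ ⟨ha0.trans_lt haτ, hτt.trans_le htT⟩ ⟨ha.1.trans_lt haτ, hτt.trans ht.2⟩
      (he ⟨haτ, hτI.2.trans hde⟩) (hneg τ ⟨haτ, hτt.le⟩)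

/-! ### Filippov solutions of the closed loop -/

theorem continuous_toEuclideanLin {Z : Type*} [TopologicalSpace Z] {n m : ℕ}
    {A : Z → Matrix (Fin n) (Fin m) ℝ} (hA : ∀ p q, Continuous fun z => A z p q) :
    Continuous fun z => LinearMap.toContinuousLinearMap (A z).toEuclideanLin :=
  (LinearMap.toContinuousLinearMap.toLinearMap ∘ₗ (Matrix.toEuclideanLin (𝕜 := ℝ) (m := Fin n)
    (n := Fin m)).toLinearMap).continuous_of_finiteDimensional.comp (continuous_matrix hA)

namespace MultiAgentSystem

variable {M K : ℕ} (S : MultiAgentSystem M) {κ : Fin M → Fin K} {k : Fin K}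

/-- The projection `x ↦ x̄_k` as a continuous linear map. -/
noncomputable def groupProjL (κ : Fin M → Fin K) (k : Fin K) : S.State →L[ℝ] S.GroupState κ k :=
  LinearMap.toContinuousLinearMap
    { toFun := S.groupProj κ k
      map_add' := fun _ _ => rfl
      map_smul' := fun _ _ => rfl }

theorem inner_gradient_groupProj (b : S.GroupState κ k → ℝ → ℝ) (xb : S.GroupState κ k) (t : ℝ)
    (v : S.State) : inner ℝ (gradient (fun y => b y t) xb) (S.groupProj κ k v) =
      ∑ i : {i : Fin M // κ i = k}, inner ℝ (S.partialGrad κ b xb t i) (v i) :=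
  PiLp.inner_apply _ _

/-- The control law of an agent in the group `k` as a function on the state space of that
group. -/
theorem exists_groupFeedback
    (u : (i : Fin M) → S.GroupState κ (κ i) → ℝ → EuclideanSpace ℝ (Fin (S.m i)))
    {P : (k : Fin K) → (i : {i : Fin M // κ i = k}) →
      (S.GroupState κ k → ℝ → EuclideanSpace ℝ (Fin (S.m i))) → Prop}
    (hu : ∀ i, P (κ i) ⟨i, rfl⟩ (u i)) (k : Fin K) (i : {i : Fin M // κ i = k}) :
    ∃ w : S.GroupState κ k → ℝ → EuclideanSpace ℝ (Fin (S.m i)),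
      (∀ x t, u i (S.groupProj κ (κ i) x) t = w (S.groupProj κ k x) t) ∧ P k i w := by
  obtain ⟨i, rfl⟩ := i
  exact ⟨u i, fun _ _ => rfl, hu i⟩

/-- Every value `v` of Filippov's map satisfies the barrier inequality. Where the gradient
vanishes it does so by assumption; elsewhere the vector field is locally bounded on the group, so
that the inequality at the neighbouring points passes to the closed convex hull. -/
theorem neg_le_inner_gradient_add_deriv_of_mem_filippovMap {b : S.GroupState κ k → ℝ → ℝ}
    {α : ℝ → ℝ} {C t : ℝ} (hC : 0 ≤ C) (hα : Continuous α)
    (hb : Continuous fun y => b y t) (hbt : Continuous fun y => deriv (fun τ => b y τ) t)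
    (hbg : Continuous (gradient fun y => b y t))
    (hf : ∀ i, Continuous fun z => S.f i z t) (hg : ∀ i p q, Continuous fun z => S.g i z t p q)
    (hc : ∀ i x, ‖S.c i x t‖ ≤ C) (hrank : ∀ i z, (S.g i z t).rank = S.n i)
    {D : Set (S.GroupState κ k)} (hD : IsOpen D)
    (hgrad : ∀ yb ∈ D, gradient (fun y => b y t) yb = 0 →
      -α (b yb t) < deriv (fun τ => b yb τ) t)
    {w : (i : {i : Fin M // κ i = k}) → S.GroupState κ k → EuclideanSpace ℝ (Fin (S.m i))}
    (hw : ∀ yb ∈ D, ∀ i, S.IsQPSolution κ b α C yb t i (w i yb))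
    {X : S.State → ℝ → S.State}
    (hX : ∀ y, ∀ i : {i : Fin M // κ i = k}, X y t i = S.f i (y i) t +
      (S.g i (y i) t).toEuclideanLin (w i (S.groupProj κ k y)) + S.c i y t)
    {x v : S.State} (hx : S.groupProj κ k x ∈ D) (hv : v ∈ filippovMap X x t) :
    -α (b (S.groupProj κ k x) t) ≤
      inner ℝ (gradient (fun y => b y t) (S.groupProj κ k x)) (S.groupProj κ k v) +
        deriv (fun τ => b (S.groupProj κ k x) τ) t := by
  set xb := S.groupProj κ k x with hxb
  rcases eq_or_ne (gradient (fun y => b y t) xb) 0 with hz | hz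
  · rw [hz, inner_zero_left, zero_add]
    exact (hgrad xb hx hz).le
  have hP : Continuous (S.groupProj κ k) := (S.groupProjL κ k).continuous
  set W : S.State → ℝ := fun y => deriv (fun τ => b (S.groupProj κ k y) τ) t +
    α (b (S.groupProj κ k y) t) with hW
  have hWc : Continuous W := (hbt.comp hP).add (hα.comp (hb.comp hP))
  suffices h : -W x ≤ (innerSL ℝ (gradient (fun y => b y t) xb)).comp (S.groupProjL κ k) v by
    have h' : -W x ≤ inner ℝ (gradient (fun y => b y t) xb) (S.groupProj κ k v) := h
    simp only [hW, ← hxb] at h'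
    linarith
  refine le_apply_of_mem_filippovMap hv _ fun ε hε => ?_
  have hnear : ∀ᶠ y in 𝓝 x, S.groupProj κ k y ∈ D :=
    hP.continuousAt.eventually (hD.mem_nhds hx)
  have hbdd : ∀ i : {i : Fin M // κ i = k}, ∃ Q, ∀ᶠ y in 𝓝 x, ‖X y t i‖ ≤ Q := by
    intro i
    have hgc := continuous_toEuclideanLin (hg i)
    obtain ⟨Q, hQ⟩ := S.exists_eventually_norm_le_of_isQPSolution hC hα hb hbt hbg i (hf i) hgc
      (hrank i _) hz
    have hxi : Continuous fun y : S.State => y i.1 := PiLp.continuous_apply 2 _ i.1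
    refine ⟨(‖S.f i (x i) t‖ + 1) + (‖LinearMap.toContinuousLinearMap
      (S.g i (x i) t).toEuclideanLin‖ + 1) * Q + C, ?_⟩
    filter_upwards [hnear, hP.continuousAt.eventually hQ,
      ((hf i).comp hxi).norm.continuousAt.eventually (gt_mem_nhds (lt_add_one _)),
      (hgc.comp hxi).norm.continuousAt.eventually (gt_mem_nhds (lt_add_one _))] with y h1 h2 h3 h4
    rw [hX y i]
    refine (norm_add₃_le).trans (add_le_add_three h3.le ?_ (hc i y))
    refine ((LinearMap.toContinuousLinearMap (S.g i (y i) t).toEuclideanLin).le_opNorm _).trans ?_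
    exact mul_le_mul h4.le (h2 _ (hw _ h1 i)) (norm_nonneg _) (by positivity)
  have hdiff : Tendsto (fun y => ∑ i : {i : Fin M // κ i = k},
      inner ℝ (S.partialGrad κ b (S.groupProj κ k y) t i - S.partialGrad κ b xb t i) (X y t i))
      (𝓝 x) (𝓝 0) := by
    rw [show (0 : ℝ) = ∑ _i : {i : Fin M // κ i = k}, (0 : ℝ) by simp]
    refine tendsto_finsetSum _ fun i _ => ?_
    obtain ⟨Q, hQ⟩ := hbdd i
    have hp : Tendsto (fun y => ‖S.partialGrad κ b (S.groupProj κ k y) t i -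
        S.partialGrad κ b xb t i‖ * Q) (𝓝 x) (𝓝 0) := by
      have hcont : Continuous fun y => ‖S.partialGrad κ b (S.groupProj κ k y) t i -
          S.partialGrad κ b xb t i‖ * Q :=
        (((S.continuous_partialGrad hbg i).comp hP).sub continuous_const).norm.mul
          continuous_const
      exact hcont.tendsto' x 0 (by simp [← hxb])
    refine squeeze_zero_norm' ?_ hp
    filter_upwards [hQ] with y hy
    exact (norm_inner_le_norm _ _).trans (mul_le_mul_of_nonneg_left hy (norm_nonneg _))
  filter_upwards [hnear, hdiff.eventually (gt_mem_nhds (half_pos hε)),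
    hWc.continuousAt.eventually (gt_mem_nhds (lt_add_of_pos_right (W x) (half_pos hε)))]
    with y h1 h2 h3
  have h4 := S.neg_le_sum_inner_of_mem_qpFeasible hC (hgrad _ h1) (fun i => (hw _ h1 i).1)
    (c := fun i => S.c i y t) (fun i => hc i y)
  have h5 : ∑ i : {i : Fin M // κ i = k}, inner ℝ (S.partialGrad κ b (S.groupProj κ k y) t i)
      (S.f i ((S.groupProj κ k y) i) t + (S.g i ((S.groupProj κ k y) i) t).toEuclideanLin
        (w i (S.groupProj κ k y)) + S.c i y t) = ∑ i : {i : Fin M // κ i = k},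
      inner ℝ (S.partialGrad κ b (S.groupProj κ k y) t i) (X y t i) :=
    Finset.sum_congr rfl fun i _ => by rw [hX y i]; rfl
  rw [h5] at h4
  simp only [inner_sub_left, Finset.sum_sub_distrib] at h2
  have h6 : (innerSL ℝ (gradient (fun y => b y t) xb)).comp (S.groupProjL κ k) (X y t) =
      ∑ i : {i : Fin M // κ i = k}, inner ℝ (S.partialGrad κ b xb t i) (X y t i) :=
    S.inner_gradient_groupProj b xb t (X y t)
  rw [h6]
  have h7 : -W y ≤ ∑ i : {i : Fin M // κ i = k},
      inner ℝ (S.partialGrad κ b (S.groupProj κ k y) t i) (X y t i) := h4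
  linarith

end MultiAgentSystem

/-! ### Correctness of the control law -/

theorem theorem2 {M K : ℕ}
    -- the agents, their dynamics, and the bound on the unknown terms `c_i`
    (S : MultiAgentSystem M) (hreg : S.Regular) (hrank : S.FullRowRank)
    (C : ℝ) (hC : 0 ≤ C) (hc : S.CouplingBound C)
    -- the partition into the groups `𝒱_k = {i | κ i = k}`, fully connected in the graph `G`
    (κ : Fin M → Fin K) (G : SimpleGraph (Fin M))
    (hG : ∀ i₁ i₂ : Fin M, κ i₁ = κ i₂ → i₁ ≠ i₂ → G.Adj i₁ i₂)
    -- the formulas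
    (r : UntilConvention) (φ : (k : Fin K) → PhiFormula (S.GroupState κ k))
    (hφ : ∀ k, (φ k).WellFormed)
    -- the control barrier functions
    (B : (k : Fin K) → BarrierData (S.GroupState κ k))
    (hB : ∀ k, AccountsFor r (φ k) (B k))
    (hcCBF : ∀ k s s', (B k).IsSwitchInterval s s' → (B k).IsCCBF s s')
    (D : (k : Fin K) → Set (S.GroupState κ k))
    (hDopen : ∀ k, IsOpen (D k)) (hDbdd : ∀ k, Bornology.IsBounded (D k))
    (hD : ∀ k s s', (B k).IsSwitchInterval s s' → ∀ t ∈ Ico s s', (B k).safeSet t ⊆ D k)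
    (α : Fin K → ℝ → ℝ) (hα : ∀ k, IsExtClassK (α k))
    (hgrad : ∀ k s s', (B k).IsSwitchInterval s s' → ∀ xb ∈ D k, ∀ t ∈ Ioo s s',
      gradient (fun y => (B k).val y t) xb = 0 →
        -α k ((B k).val xb t) < deriv (fun τ => (B k).val xb τ) t) :
    -- the quadratic programs that define the control law have exactly one solution
    (∀ i s s', (B (κ i)).IsSwitchInterval s s' → ∀ xb ∈ D (κ i), ∀ t ∈ Ioo s s',
      ∃! v, S.IsQPSolution κ (B (κ i)).val (α (κ i)) C xb t ⟨i, rfl⟩ v) ∧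
    -- under this control law every Filippov solution satisfies the formulas
    ∀ u : (i : Fin M) → S.GroupState κ (κ i) → ℝ → EuclideanSpace ℝ (Fin (S.m i)),
      (∀ i s s', (B (κ i)).IsSwitchInterval s s' → ∀ xb ∈ D (κ i), ∀ t ∈ Ioo s s',
        S.IsQPSolution κ (B (κ i)).val (α (κ i)) C xb t ⟨i, rfl⟩ (u i xb t)) →
      ∀ (T : ℝ) (x : ℝ → S.State), 0 < T → IsFilippovSolution (S.closedLoop κ u) T x →
        ∀ k, S.groupProj κ k (x 0) ∈ (B k).safeSet 0 →
          (∀ s s', (B k).IsSwitchInterval s s' → ∀ t ∈ Ico s s', t ≤ T →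
            S.groupProj κ k (x t) ∈ (B k).safeSet t) ∧
          ((φ k).horizon ≤ T →
            (φ k).toSTL.Sat r (fun t => S.groupProj κ k (x t)) 0) := by
  have hpos : ∀ k, ∀ c ∈ (B k).comps, 0 < c.2 := fun k => (hB k).2.2.2.removal_pos (hφ k)
  have htime : ∀ k s s', (B k).IsSwitchInterval s s' → ∀ t ∈ Ioo s s', 0 ≤ t :=
    fun k s s' h t ht => (h.start_nonneg (hpos k)).trans ht.1.le
  refine ⟨fun i s s' h xb hxb t ht => S.existsUnique_isQPSolution _
    (hrank _ _ _ (htime _ s s' h t ht)) (hgrad _ s s' h xb hxb t ht), ?_⟩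
  intro u hu T x hT hx k hx0
  obtain ⟨hη, hcomps, hextra, henc⟩ := hB k
  have hxc : ContinuousOn x (Icc 0 T) := uIcc_of_le hT.le ▸ hx.1.continuousOn
  have hyc : ContinuousOn (fun t => S.groupProj κ k (x t)) (Icc 0 T) :=
    (S.groupProjL κ k).continuous.comp_continuousOn hxc
  have hyac : AbsolutelyContinuousOnInterval (fun t => S.groupProj κ k (x t)) 0 T :=
    ((S.groupProjL κ k).lipschitz.lipschitzOnWith
      (s := univ)).comp_absolutelyContinuousOnInterval hx.1 (mapsTo_univ _ _)
  choose w hwu hw using S.exists_groupFeedback u (P := fun k i w => ∀ s s',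
    (B k).IsSwitchInterval s s' → ∀ xb ∈ D k, ∀ t ∈ Ioo s s',
      S.IsQPSolution κ (B k).val (α k) C xb t i (w xb t)) hu k
  have hinv : ∀ s s', (B k).IsSwitchInterval s s' → S.groupProj κ k (x s) ∈ (B k).safeSet s →
      ∀ t ∈ Ico s s', t ≤ T → S.groupProj κ k (x t) ∈ (B k).safeSet t := by
    intro s s' h hxs t ht htT
    have hF := (hcCBF k s s' h).1
    have hs0 : 0 ≤ s := h.start_nonneg (hpos k)
    refine nonneg_along_curve (F := (B k).val) (y := fun t => S.groupProj κ k (x t)) hF hs0 hyac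
      (hDopen k) (fun τ hτ z hz => hD k s s' h τ hτ hz) hxs ?_ ht htT ?_
    · -- outside the safe set `α` is negative, so the barrier inequality makes the barrier increase
      filter_upwards [hx.2] with τ hτ hτT hτs hτD hneg
      obtain ⟨v, hv, hderiv⟩ := hτ hτT
      have hy : HasDerivAt (fun t => S.groupProj κ k (x t)) (S.groupProj κ k v) τ :=
        (S.groupProjL κ k).hasFDerivAt.comp_hasDerivAt τ hderiv
      rw [(hasDerivAt_along_curve (hF.differentiableAt_strip hτs _) hy).deriv]
      have hτ0 : 0 ≤ τ := hτT.1.le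
      have hbound := S.neg_le_inner_gradient_add_deriv_of_mem_filippovMap hC (hα k).2.2.continuous
        (hF.continuous_strip hτs) (hF.continuous_deriv_strip hτs) (hF.continuous_gradient_strip hτs)
        (fun i => ((hreg i).1 τ hτ0).continuous)
        (fun i p q => ((hreg i).2.1 τ hτ0 p q).continuous) (fun i z => hc i z τ hτ0)
        (fun i z => hrank i z τ hτ0) (hDopen k) (fun yb hyb => hgrad k s s' h yb hyb τ hτs)
        (w := fun i yb => w i yb τ) (fun yb hyb i => hw i s s' h yb hyb τ hτs)
        (X := S.closedLoop κ u) (fun y i => by rw [← hwu i y τ]; rfl) hτD hv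
      have hαneg : α k ((B k).val (S.groupProj κ k (x τ)) τ) < 0 := by
        have := (hα k).1 hneg
        rwa [(hα k).2.1] at this
      linarith
    · -- the barrier is `C¹` on the open interval only; continuity at `s` comes from the frozen sum
      have hsum := (BarrierData.continuousOn_frozenSum_curve hcomps hextra hyc s).mono
        (Icc_subset_Icc hs0 htT)
      refine ((continuousOn_const (c := -(1 / (B k).η))).mul (hsum.log fun τ _ => (h.frozenSum_pos _ _).ne')).congr ?_
      intro τ hτ
      change -(1 / (B k).η) * Real.log _ = _
      rw [h.expSum_eq ⟨hτ.1, hτ.2.trans_lt ht.2⟩]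
      rfl
  have hsafe : ∀ s s', (B k).IsSwitchInterval s s' → ∀ t ∈ Ico s s', t ≤ T →
      S.groupProj κ k (x t) ∈ (B k).safeSet t := fun s s' h =>
    BarrierData.mem_safeSet_of_switch_invariant (y := fun t => S.groupProj κ k (x t)) hη (hpos k)
      hcomps hextra hyc hinv hx0 h
  exact ⟨hsafe, fun hhor => henc.sat (hφ k) hhor fun c hcm hcT =>
    BarrierData.comp_nonneg_of_mem_safeSet (y := fun t => S.groupProj κ k (x t)) hη (hpos k)
      hcomps hyc hsafe hcm hcT⟩
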